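/- Let $\mathbb{C}_+=\{z\in\mathbb{C}:\operatorname{Re} z>0\}$. Let $\tilde\nu$ be a nonzero positive regular Borel measure on $[0,\infty)$ satisfying the $\Delta_2$-condition $$\sup_{r>0}\frac{\tilde\nu[0,2r)}{\tilde\nu[0,r)}<\infty ,$$ and let $\nu=\tilde\nu\otimes\lambda$ on $\overline{\mathbb{C}_+}=[0,\infty)\times i\mathbb{R}$, where $\lambda$ is Lebesgue measure on $i\mathbb{R}$. The Zen space $A^2_\nu$ consists of all analytic $F:\mathbb{C}_+\to\mathbb{C}$ with $$\|F\|_{A^2_\nu}^2:=\sup_{\varepsilon>0}\int_{\overline{\mathbb{C}_+}}|F(z+\varepsilon)|^2\,d\nu(z)<\infty .$$ Put $w(t)=2\pi\int_{[0,\infty)} e^{-2rt}\,d\tilde\nu(r)$ for $t>0$, let $L^2_w(0,\infty)$ be the space of measurable $f:(0,\infty)\to\mathbb{C}$ (modulo equality a.e.) with $\int_0^\infty|f(t)|^2w(t)\,dt<\infty$, and assume that the Laplace transform $\mathfrak{L}:L^2_w(0,\infty)\to A^2_\nu$, $\mathfrak{L}f(z)=\int_0^\infty e^{-tz}f(t)\,dt$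 (which is isometric), is surjective. An operator $B$ on $A^2_\nu$ is called causal if for every $T>0$ the operator $\mathfrak{L}^{-1}B\mathfrak{L}$ maps $L^2_w(T,\infty)$ (the functions in $L^2_w(0,\infty)$ that vanish a.e. on $(0,T]$) into itself. For $\alpha>-1$ let $\mathcal{B}^2_\alpha(\mathbb{C}_+)$ be the weighted Bergman space of all analytic $F:\mathbb{C}_+\to\mathbb{C}$ with $$\|F\|_{\mathcal{B}^2_\alpha(\mathbb{C}_+)}^2:=\frac1\pi\int_{\mathbb{C}_+}(\operatorname{Re} z)^\alpha|F(z)|^2\,dA(z)<\infty ,$$ where $dA$ is Lebesgue area measure. **Theorem.** Let $h:\mathbb{C}_+\to\mathbb{C}$ and $\varphi:\mathbb{C}_+\to\mathbb{C}_+$ be analytic, and suppose that the weighted composition operator $W_{h,\varphi}F=h\cdot(F\circ\varphi)$ is bounded and causal on $A^2_\nu$. Then there exists $\alpha'\ge 0$ such that for every real $\alpha\ge\alpha'$ the operator $W_{h,\varphi}$ is bounded on $\mathcal{B}^2_\alpha(\mathbb{C}_+)$, and $$\|W_{h,\varphi}\|_{\mathcal{B}^2_\alpha(\mathbb{C}_+)}\le\|W_{h,\varphi}\|_{A^2_\nu}.$$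 -/

import Mathlib

open MeasureTheory Set
open scoped ENNReal NNReal

noncomputable section

namespace Zen

/-- The open right complex half-plane. -/
def rightHalfPlane : Set ℂ := {z | 0 < z.re}

/-! Functions on the half-plane are represented by functions `ℂ → ℂ`; none of the notions below
depends on their values outside the open right half-plane. -/

/-- The `Δ₂` condition `sup_{r > 0} ν̃[0, 2r) / ν̃[0, r) < ∞`. For a nonzero locally finite measure
it forces every `ν̃[0, r)`, `r > 0`, to be positive, so that all quotients are meaningful. -/
def DeltaTwo (ν : Measure ℝ≥0) : Prop :=
  ⨆ r : ℝ≥0, ⨆ _ : 0 < r, ν (Iio (2 * r)) / ν (Iio r) < ∞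

/-- The measure `ν = ν̃ ⊗ λ` on the closed right half-plane, as a measure on `ℂ`. -/
def halfPlaneMeasure (ν : Measure ℝ≥0) : Measure ℂ :=
  (ν.prod (volume : Measure ℝ)).map (fun p => (⟨(p.1 : ℝ), p.2⟩ : ℂ))

/-- The norm of the Zen space `A²_ν`, with value `∞` for functions of infinite norm. -/
def zenNorm (ν : Measure ℝ≥0) (F : ℂ → ℂ) : ℝ≥0∞ :=
  (⨆ ε : ℝ, ⨆ _ : 0 < ε, ∫⁻ z, ‖F (z + (ε : ℂ))‖ₑ ^ 2 ∂(halfPlaneMeasure ν)) ^ (1 / 2 : ℝ)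

/-- The norm of the weighted Bergman space `B²_α`, `α > -1`, with value `∞` for functions of
infinite norm. -/
def bergmanNorm (α : ℝ) (F : ℂ → ℂ) : ℝ≥0∞ :=
  (∫⁻ z in rightHalfPlane, ENNReal.ofReal (z.re ^ α / Real.pi) * ‖F z‖ₑ ^ 2) ^ (1 / 2 : ℝ)

/-- The space of analytic functions on the right half-plane with finite norm `N`. -/
def analyticSpace (N : (ℂ → ℂ) → ℝ≥0∞) : Set (ℂ → ℂ) :=
  {F | DifferentiableOn ℂ F rightHalfPlane ∧ N F < ∞}

/-- The Zen space `A²_ν`. -/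
def zenSpace (ν : Measure ℝ≥0) : Set (ℂ → ℂ) := analyticSpace (zenNorm ν)

/-- The operator norm of `B` on the space of analytic functions with norm `N`
(`∞` if there is no finite bound). -/
def opNorm (N : (ℂ → ℂ) → ℝ≥0∞) (B : (ℂ → ℂ) → (ℂ → ℂ)) : ℝ≥0∞ :=
  sInf {C : ℝ≥0∞ | ∀ F ∈ analyticSpace N, N (B F) ≤ C * N F}

/-- `B` is a bounded operator from the space of analytic functions with norm `N` to itself. -/
def IsBoundedOn (N : (ℂ → ℂ) → ℝ≥0∞) (B : (ℂ → ℂ) → (ℂ → ℂ)) : Prop :=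
  MapsTo B (analyticSpace N) (analyticSpace N) ∧ opNorm N B < ∞

/-- The weighted composition operator `W_{h,φ} F = h · (F ∘ φ)`. -/
def weightedComp (h φ : ℂ → ℂ) (F : ℂ → ℂ) : ℂ → ℂ := fun z => h z * F (φ z)

/-- The weight `w(t) = 2π ∫ e^{-2rt} dν̃(r)`. -/
def weight (ν : Measure ℝ≥0) (t : ℝ) : ℝ≥0∞ :=
  ENNReal.ofReal (2 * Real.pi) * ∫⁻ r : ℝ≥0, ENNReal.ofReal (Real.exp (-(2 * (r : ℝ) * t))) ∂ν

/-- The measure `w(t) dt` on `(0, ∞)`, as a measure on `ℝ`. -/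
def weightedMeasure (w : ℝ → ℝ≥0∞) : Measure ℝ :=
  (volume.restrict (Ioi (0 : ℝ))).withDensity w

/-- The weighted space `L²_w(0, ∞)`. -/
abbrev L2 (w : ℝ → ℝ≥0∞) : Type := Lp ℂ 2 (weightedMeasure w)

/-- `A` is causal on `L²_w(0, ∞)`: for each `T > 0` the subspace `L²_w(T, ∞)`, i.e. the functions
vanishing a.e. on `(0, T]`, is invariant for `A`. -/
def IsCausal {w : ℝ → ℝ≥0∞} (A : L2 w →ₗ[ℂ] L2 w) : Prop :=
  ∀ T : ℝ, 0 < T → ∀ f : L2 w,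
    (∀ᵐ t ∂(weightedMeasure w), t ≤ T → f t = 0) →
      ∀ᵐ t ∂(weightedMeasure w), t ≤ T → A f t = 0

/-- The Laplace transform. -/
def laplace (f : ℝ → ℂ) (z : ℂ) : ℂ :=
  ∫ t in Ioi (0 : ℝ), Complex.exp (-((t : ℂ) * z)) * f t

/-- The Laplace transform `L²_w(0, ∞) → A²_ν` is surjective. -/
def LaplaceSurjective (ν : Measure ℝ≥0) : Prop :=
  ∀ F ∈ zenSpace ν, ∃ f : L2 (weight ν), EqOn (laplace f) F rightHalfPlane

/-- `B` is causal on `A²_ν`: the operator `A = 𝔏⁻¹ B 𝔏` on `L²_w(0, ∞)`, i.e. the operator with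
`𝔏 A = B 𝔏`, is causal. -/
def IsCausalOnZen (ν : Measure ℝ≥0) (B : (ℂ → ℂ) → (ℂ → ℂ)) : Prop :=
  ∃ A : L2 (weight ν) →ₗ[ℂ] L2 (weight ν),
    (∀ f : L2 (weight ν), EqOn (laplace (A f)) (B (laplace f)) rightHalfPlane) ∧ IsCausal A

end Zen

end

/-! By Plancherel on vertical lines, the Laplace transform turns the Zen norm into the norm of L²_w
and the Bergman norm into that of L² with weight c_α t^{-(α+1)}. A causal operator A on L²_w with
squared bound C² satisfies ∫_{(0,T]} |Af|² w ≤ C² ∫_{(0,T]} |f|² w for every T, because Af on (0,T]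
depends only on f there. Superlevel sets of a decreasing function u ≥ 0 are initial intervals, so
the layer-cake formula gives the same inequality, with the same C, for the weight u·w
(`Zen.IsCausal.lintegral_mul_le`).

It remains to take u(t) = t^{-(α+1)}/w(t) and see that it decreases for large α. The Δ₂-condition
gives w(t/2) ≤ R w(t); combined with convexity of w it yields w(t) ≤ (t'/t)^{2(R-1)} w(t') for t ≤
t' (`Zen.Doubling.weight_toReal_le`). Doubling alone would leave a multiplicative constant here,
which would spoil exact monotonicity and hence the comparison of norms.

This settles functions that are Laplace transforms from L²_w, that is, by surjectivity, those in the
Zen space. A general Bergman function F is approximated pointwise by F(z+ε) e^{-εz}/(1+εz), which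
lies in the Zen space and has no larger Bergman norm; Fatou's lemma concludes
(`Zen.bergmanNorm_weightedComp_le`). -/

/-! ### Plancherel for the Fourier and Laplace transforms. -/

/-- The square of the `L²` seminorm is the integral of the square. -/
theorem eLpNorm_two_sq {α : Type*} [MeasurableSpace α] (f : α → ℂ) (μ : Measure α) :
    eLpNorm f 2 μ ^ 2 = ∫⁻ x, ‖f x‖ₑ ^ 2 ∂μ := by
  have := eLpNorm_nnreal_pow_eq_lintegral (f := f) (μ := μ) (p := 2) (by norm_num)
  simpa using this

theorem memLp_two_iff_lintegral {α : Type*} [MeasurableSpace α] {f : α → ℂ} {μ : Measure α} :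
    MemLp f 2 μ ↔ AEStronglyMeasurable f μ ∧ ∫⁻ x, ‖f x‖ₑ ^ 2 ∂μ < ∞ := by
  rw [MemLp, ← eLpNorm_two_sq, ENNReal.pow_lt_top_iff]
  simp

open FourierTransform in
/-- **Plancherel's theorem** for integrable square-integrable functions. -/
theorem fourier_toLp_ae_eq {g : ℝ → ℂ} (h1 : Integrable g) (h2 : MemLp g 2) :
    (𝓕 (h2.toLp g) : Lp ℂ 2 (volume : Measure ℝ)) =ᵐ[volume] 𝓕 g := by
  have hcont : Continuous (𝓕 g) :=
    VectorFourier.fourierIntegral_continuous Real.continuous_fourierChar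
      continuous_inner h1
  -- Both transforms are tested against smooth compactly supported functions: on the L² side by the
  -- definition of the distributional transform, on the L¹ side by Fubini.
  refine ae_eq_of_integral_contDiff_smul_eq
    ((Lp.memLp _).locallyIntegrable (by norm_num)) hcont.locallyIntegrable ?_
  intro ψ hψ hs
  have hψ' : ContDiff ℝ (⊤ : ℕ∞) (fun x => (ψ x : ℂ)) := Complex.ofRealCLM.contDiff.comp hψ
  have hs' : HasCompactSupport (fun x => (ψ x : ℂ)) := hs.comp_left Complex.ofReal_zero
  let Ψ : SchwartzMap ℝ ℂ := hs'.toSchwartzMap hψ'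
  have hΨ : ∀ x, Ψ x = (ψ x : ℂ) := fun x => rfl
  have key := congrArg (fun T => T Ψ) (Lp.fourier_toTemperedDistribution_eq (h2.toLp g))
  simp only [TemperedDistribution.fourier_apply, Lp.toTemperedDistribution_apply] at key
  have e1 : ∫ x, ψ x • (𝓕 (h2.toLp g) : Lp ℂ 2 (volume : Measure ℝ)) x
      = ∫ x, Ψ x • (𝓕 (h2.toLp g) : Lp ℂ 2 (volume : Measure ℝ)) x := by
    simp [hΨ]
  have e2 : ∫ x, (𝓕 Ψ) x • (h2.toLp g) x = ∫ x, (𝓕 Ψ) x • g x := by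
    refine integral_congr_ae ?_
    filter_upwards [h2.coeFn_toLp] with x hx
    rw [hx]
  have e3 : ∫ x, (𝓕 Ψ) x • g x = ∫ x, Ψ x • 𝓕 g x := by
    have := VectorFourier.integral_fourierIntegral_smul_eq_flip (L := innerₗ ℝ)
      Real.continuous_fourierChar continuous_inner (Ψ.integrable (μ := volume)) h1
    rw [SchwartzMap.fourier_coe]
    rw [flip_innerₗ] at this
    exact this
  rw [e1, ← key, e2, e3]
  simp [hΨ]

open FourierTransform in
theorem lintegral_enorm_fourier_sq {g : ℝ → ℂ} (h1 : Integrable g) (h2 : MemLp g 2) :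
    ∫⁻ x, ‖𝓕 g x‖ₑ ^ 2 = ∫⁻ x, ‖g x‖ₑ ^ 2 := by
  have hn : ‖(𝓕 (h2.toLp g) : Lp ℂ 2 (volume : Measure ℝ))‖ₑ = ‖h2.toLp g‖ₑ := by
    rw [← ofReal_norm, ← ofReal_norm, Lp.norm_fourier_eq]
  rw [Lp.enorm_def, Lp.enorm_def, eLpNorm_congr_ae (fourier_toLp_ae_eq h1 h2),
    eLpNorm_congr_ae h2.coeFn_toLp] at hn
  have hsq := congrArg (· ^ 2) hn
  simp only [eLpNorm_two_sq] at hsq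
  exact hsq

open FourierTransform in
/-- Plancherel's theorem for the Laplace transform on vertical lines. -/
theorem lintegral_enorm_laplace_sq {f : ℝ → ℂ} {x : ℝ}
    (h1 : IntegrableOn (fun t : ℝ => Complex.exp (-((t : ℂ) * x)) * f t) (Ioi 0))
    (h2 : MemLp (fun t : ℝ => Complex.exp (-((t : ℂ) * x)) * f t) 2 (volume.restrict (Ioi 0))) :
    ∫⁻ y : ℝ, ‖Zen.laplace f ⟨x, y⟩‖ₑ ^ 2 =
      ENNReal.ofReal (2 * Real.pi) *
        ∫⁻ t in Ioi (0 : ℝ), ENNReal.ofReal (Real.exp (-(2 * x * t))) * ‖f t‖ₑ ^ 2 := by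
  set g : ℝ → ℂ := (Ioi (0 : ℝ)).indicator (fun t : ℝ => Complex.exp (-((t : ℂ) * x)) * f t)
    with hg
  have g1 : Integrable g := (integrable_indicator_iff measurableSet_Ioi).2 h1
  have g2 : MemLp g 2 := (memLp_indicator_iff_restrict measurableSet_Ioi).2 h2
  -- The Fourier kernel is e^{-2πitξ}, so the line is parametrised by y = 2πξ; the Jacobian is the
  -- factor 2π in `weight`.
  have hF : ∀ ξ : ℝ, Zen.laplace f ⟨x, 2 * Real.pi * ξ⟩ = 𝓕 g ξ := by
    intro ξ
    rw [Real.fourier_real_eq_integral_exp_smul, Zen.laplace, ← integral_indicator measurableSet_Ioi]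
    congr 1
    ext t
    by_cases ht : t ∈ Ioi (0 : ℝ)
    · simp only [hg, indicator_of_mem ht, smul_eq_mul, ← mul_assoc, ← Complex.exp_add]
      congr 2
      apply Complex.ext <;> simp <;> ring
    · simp [hg, indicator_of_notMem ht]
  have h2pi : (0 : ℝ) < 2 * Real.pi := by positivity
  have hcv : ∀ F : ℝ → ℝ≥0∞,
      ∫⁻ y, F y = ENNReal.ofReal (2 * Real.pi) * ∫⁻ ξ, F (2 * Real.pi * ξ) := by
    intro F
    conv_lhs => rw [← Real.smul_map_volume_mul_left h2pi.ne']
    rw [lintegral_smul_measure, abs_of_pos h2pi, smul_eq_mul]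
    congr 1
    exact (Homeomorph.mulLeft₀ (2 * Real.pi) h2pi.ne').isClosedEmbedding.measurableEmbedding
      |>.lintegral_map F
  rw [hcv]
  simp only [hF]
  rw [lintegral_enorm_fourier_sq g1 g2, ← lintegral_indicator measurableSet_Ioi]
  congr 2
  ext t
  by_cases ht : t ∈ Ioi (0 : ℝ)
  · simp only [hg, indicator_of_mem ht, enorm_mul, mul_pow]
    congr 1
    rw [← ofReal_norm, Complex.norm_exp, ← ENNReal.ofReal_pow (Real.exp_nonneg _),
      ← Real.exp_nat_mul]
    congr 2
    simp
    ring
  · simp [hg, indicator_of_notMem ht]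

/-! ### Doubling of the measure and growth of the weight. -/

namespace Zen

variable {ν : Measure ℝ≥0} {R : ℝ}

/-- A quantitative doubling condition for initial segments. -/
structure Doubling (ν : Measure ℝ≥0) (R : ℝ) : Prop where
  one_le : 1 ≤ R
  measure_le : ∀ r : ℝ≥0, 0 < r → ν (Iio (2 * r)) ≤ ENNReal.ofReal R * ν (Iio r)
  measure_ne_zero : ∀ r : ℝ≥0, 0 < r → ν (Iio r) ≠ 0
  measure_ne_top : ∀ r : ℝ≥0, ν (Iio r) ≠ ∞

theorem measure_Iio_pow_le
    (h : ∀ r : ℝ≥0, 0 < r → ν (Iio (2 * r)) ≤ ENNReal.ofReal R * ν (Iio r)) {r : ℝ≥0}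
    (hr : 0 < r) (n : ℕ) : ν (Iio (2 ^ n * r)) ≤ ENNReal.ofReal R ^ n * ν (Iio r) := by
  induction n with
  | zero => simp
  | succ n ih =>
    calc ν (Iio (2 ^ (n + 1) * r)) = ν (Iio (2 * (2 ^ n * r))) := by rw [pow_succ']; ring_nf
      _ ≤ ENNReal.ofReal R * ν (Iio (2 ^ n * r)) := h _ (by positivity)
      _ ≤ ENNReal.ofReal R * (ENNReal.ofReal R ^ n * ν (Iio r)) := by gcongr
      _ = _ := by ring

theorem iUnion_Iio_pow {r : ℝ≥0} (hr : 0 < r) : ⋃ n : ℕ, Iio (2 ^ n * r) = univ := by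
  refine eq_univ_of_forall fun x => mem_iUnion.2 ?_
  obtain ⟨n, hn⟩ := pow_unbounded_of_one_lt (x / r) (one_lt_two : (1 : ℝ≥0) < 2)
  exact ⟨n, (div_lt_iff₀ hr).1 hn⟩

theorem DeltaTwo.exists_doubling [IsFiniteMeasureOnCompacts ν] (hν : ν ≠ 0) (hΔ : DeltaTwo ν) :
    ∃ R, Doubling ν R := by
  unfold DeltaTwo at hΔ
  set S : ℝ≥0∞ := ⨆ r : ℝ≥0, ⨆ _ : 0 < r, ν (Iio (2 * r)) / ν (Iio r) with hS
  -- A positive quantity divided by 0 is ∞, so finiteness of the supremum covers null segments as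
  -- well. The added 1 ensures R ≥ 1.
  have hle : ∀ r : ℝ≥0, 0 < r → ν (Iio (2 * r)) ≤ ENNReal.ofReal (S.toReal + 1) * ν (Iio r) := by
    intro r hr
    have h1 : ν (Iio (2 * r)) / ν (Iio r) ≤ S := le_iSup₂_of_le r hr le_rfl
    rw [ENNReal.ofReal_add ENNReal.toReal_nonneg zero_le_one, ENNReal.ofReal_toReal hΔ.ne,
      ENNReal.ofReal_one]
    refine (ENNReal.div_le_iff_le_mul (Or.inr ?_) (Or.inr (by simp))).1 (h1.trans le_self_add)
    exact (ENNReal.add_lt_top.2 ⟨hΔ, ENNReal.one_lt_top⟩).ne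
  refine ⟨S.toReal + 1, by simp, hle, fun r hr h0 => hν ?_, fun r => ?_⟩
  -- Doubling would propagate a null initial segment to all of [0, ∞).
  · rw [← Measure.measure_univ_eq_zero, ← iUnion_Iio_pow hr, measure_iUnion_null_iff]
    intro n
    simpa [h0] using measure_Iio_pow_le hle hr n
  · exact ((measure_mono Iio_subset_Iic_self).trans_lt
      ((by rw [← Icc_bot]; exact isCompact_Icc : IsCompact (Iic r)).measure_lt_top)).ne

@[fun_prop]
theorem measurable_weight [SFinite ν] : Measurable (weight ν) := by
  unfold weight
  refine Measurable.const_mul (Measurable.lintegral_prod_right' (f := fun p : ℝ × ℝ≥0 =>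
    ENNReal.ofReal (Real.exp (-(2 * (p.2 : ℝ) * p.1)))) ?_) _
  fun_prop

namespace Doubling

/-- On the dyadic shell [2^n, 2^{n+1}) the exponential is at most e^{-2·2^n t}, while the mass grows
at most like R^{n+1}. -/
theorem weight_ne_top (hD : Doubling ν R) {t : ℝ} (ht : 0 < t) : weight ν t ≠ ∞ := by
  have hR : 0 ≤ R := zero_le_one.trans hD.one_le
  refine ENNReal.mul_ne_top ENNReal.ofReal_ne_top ?_
  let a : ℕ → ℝ := fun n => R ^ (n + 1) * Real.exp (-(2 * 2 ^ n * t))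
  have hpt : ∀ r : ℝ≥0, ENNReal.ofReal (Real.exp (-(2 * (r : ℝ) * t))) ≤
      (Iio (1 : ℝ≥0)).indicator 1 r + ∑' n : ℕ, ENNReal.ofReal (Real.exp (-(2 * 2 ^ n * t))) *
        (Iio (2 ^ (n + 1) * (1 : ℝ≥0))).indicator 1 r := by
    intro r
    rcases lt_or_ge r 1 with hr | hr
    · refine le_trans ?_ le_self_add
      rw [indicator_of_mem (mem_Iio.2 hr), Pi.one_apply, ENNReal.ofReal_le_one,
        Real.exp_le_one_iff]
      have := r.coe_nonneg
      nlinarith [mul_nonneg this ht.le]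
    · obtain ⟨n, h1, h2⟩ := exists_nat_pow_near hr (one_lt_two : (1 : ℝ≥0) < 2)
      refine le_trans ?_ le_add_self
      refine le_trans ?_ (ENNReal.le_tsum n)
      rw [indicator_of_mem (by simpa using h2), Pi.one_apply, mul_one]
      have h1' : (2 : ℝ) ^ n ≤ r := by exact_mod_cast h1
      gcongr
  have hsum : Summable a := by
    -- With 2^k > R, the bound e^{-x} ≤ k!/x^k gives a geometric majorant of ratio R/2^k.
    obtain ⟨k, hk⟩ := pow_unbounded_of_one_lt R (one_lt_two : (1 : ℝ) < 2)
    have hg : Summable fun n : ℕ => (R * (k.factorial / (2 * t) ^ k)) * (R / 2 ^ k) ^ n :=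
      (summable_geometric_of_lt_one (by positivity)
        (by rw [div_lt_one (by positivity)]; exact hk)).mul_left _
    refine Summable.of_nonneg_of_le (fun n => by positivity) (fun n => ?_) hg
    have h1 := Real.pow_div_factorial_le_exp (2 * 2 ^ n * t) (by positivity) k
    have h2 : Real.exp (-(2 * 2 ^ n * t)) ≤ k.factorial / (2 * 2 ^ n * t) ^ k := by
      rw [Real.exp_neg, inv_le_comm₀ (Real.exp_pos _) (by positivity), inv_div]
      exact h1
    calc a n ≤ R ^ (n + 1) * (k.factorial / (2 * 2 ^ n * t) ^ k) := by
          simp only [a]; gcongr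
      _ = _ := by
          rw [mul_pow, mul_pow, mul_pow, div_pow, ← pow_mul, ← pow_mul, mul_comm k n]
          field_simp
          ring
  have hmeas : ∀ r : ℝ≥0, Measurable ((Iio r).indicator (1 : ℝ≥0 → ℝ≥0∞)) := fun r =>
    measurable_one.indicator measurableSet_Iio
  refine ne_top_of_le_ne_top ?_ (lintegral_mono hpt)
  rw [lintegral_add_left (hmeas 1), lintegral_tsum fun n => ((hmeas _).const_mul _).aemeasurable]
  simp_rw [lintegral_const_mul _ (hmeas _), lintegral_indicator_one measurableSet_Iio]
  refine ENNReal.add_ne_top.2 ⟨hD.measure_ne_top 1, ?_⟩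
  have hle : ∀ n : ℕ, ENNReal.ofReal (Real.exp (-(2 * 2 ^ n * t))) *
      ν (Iio (2 ^ (n + 1) * (1 : ℝ≥0))) ≤ ENNReal.ofReal (a n) * ν (Iio 1) := by
    intro n
    rw [ENNReal.ofReal_mul (by positivity), ENNReal.ofReal_pow hR,
      mul_comm (ENNReal.ofReal R ^ _), mul_assoc (ENNReal.ofReal _)]
    exact mul_le_mul_right (measure_Iio_pow_le hD.measure_le one_pos _) _
  refine ne_top_of_le_ne_top ?_ (ENNReal.tsum_le_tsum hle)
  rw [ENNReal.tsum_mul_right]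
  exact ENNReal.mul_ne_top hsum.tsum_ofReal_ne_top (hD.measure_ne_top 1)

/-- The weight is bounded below by exponentials of arbitrarily small rate. -/
theorem le_weight (r : ℝ≥0) {t : ℝ} (ht : 0 ≤ t) :
    ENNReal.ofReal (2 * Real.pi) * (ENNReal.ofReal (Real.exp (-(2 * r * t))) * ν (Iio r)) ≤
      weight ν t := by
  unfold weight
  gcongr
  rw [← setLIntegral_const]
  refine (setLIntegral_mono' measurableSet_Iio fun s hs => ?_).trans (setLIntegral_le_lintegral _ _)
  have : (s : ℝ) ≤ r := by exact_mod_cast (le_of_lt hs)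
  gcongr

theorem weight_ne_zero (hD : Doubling ν R) {t : ℝ} (ht : 0 ≤ t) : weight ν t ≠ 0 := by
  refine ne_of_gt (lt_of_lt_of_le ?_ (le_weight (ν := ν) 1 ht))
  have := hD.measure_ne_zero 1 one_pos
  have h2 := Real.pi_pos
  refine pos_iff_ne_zero.2 (mul_ne_zero ?_ (mul_ne_zero ?_ this))
  · simpa using h2
  · simpa using Real.exp_pos _

/-- Layer by layer: if e^{-2at} > u cuts out [0, s), then halving t cuts out [0, 2s), so Δ₂ applies
to each level set. -/
theorem weight_le (hD : Doubling ν R) {t : ℝ} (ht : 0 < t) :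
    weight ν (t / 2) ≤ ENNReal.ofReal R * weight ν t := by
  unfold weight
  rw [mul_left_comm]
  gcongr
  rw [lintegral_eq_lintegral_meas_lt _ (ae_of_all _ fun _ => (Real.exp_pos _).le) (by fun_prop),
    lintegral_eq_lintegral_meas_lt _ (ae_of_all _ fun _ => (Real.exp_pos _).le) (by fun_prop),
    ← lintegral_const_mul' _ _ ENNReal.ofReal_ne_top]
  refine setLIntegral_mono' measurableSet_Ioi fun u hu => ?_
  have hu : 0 < u := hu
  rcases le_or_gt 1 u with h1 | h1
  · have : {a : ℝ≥0 | u < Real.exp (-(2 * (a : ℝ) * (t / 2)))} = ∅ := by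
      refine eq_empty_of_forall_notMem fun a ha => ?_
      have h2 : Real.exp (-(2 * (a : ℝ) * (t / 2))) ≤ 1 := by
        rw [Real.exp_le_one_iff]
        have := a.coe_nonneg
        nlinarith [mul_nonneg this ht.le]
      exact absurd (lt_of_lt_of_le ha h2) (not_lt.2 h1)
    simp [this]
  · have hlog : Real.log u < 0 := Real.log_neg hu h1
    have hs : 0 < -Real.log u / (2 * t) := div_pos (by linarith) (by linarith)
    set s : ℝ≥0 := ⟨-Real.log u / (2 * t), hs.le⟩ with hsd
    have hsv : (s : ℝ) = -Real.log u / (2 * t) := rfl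
    have e1 : {a : ℝ≥0 | u < Real.exp (-(2 * (a : ℝ) * (t / 2)))} = Iio (2 * s) := by
      ext a
      rw [mem_ofPred_eq, mem_Iio, ← NNReal.coe_lt_coe, ← Real.log_lt_iff_lt_exp hu, NNReal.coe_mul,
        hsv, NNReal.coe_ofNat, mul_div_assoc' 2 (-Real.log u),
        mul_div_mul_left _ _ two_ne_zero, lt_div_iff₀ ht]
      constructor <;> intro h <;> linarith
    have e2 : {a : ℝ≥0 | u < Real.exp (-(2 * (a : ℝ) * t))} = Iio s := by
      ext a
      rw [mem_ofPred_eq, mem_Iio, ← NNReal.coe_lt_coe, ← Real.log_lt_iff_lt_exp hu,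
        hsv, lt_div_iff₀ (by positivity)]
      constructor <;> intro h <;> linarith
    rw [e1, e2]
    exact hD.measure_le s hs

/-- The weight is a positive superposition of the convex functions t ↦ e^{-2rt}. -/
theorem weight_convex {s t θ : ℝ} (h0 : 0 ≤ θ) (h1 : θ ≤ 1) :
    weight ν (θ * s + (1 - θ) * t) ≤
      ENNReal.ofReal θ * weight ν s + ENNReal.ofReal (1 - θ) * weight ν t := by
  unfold weight
  rw [mul_left_comm, mul_left_comm (ENNReal.ofReal (1 - θ)), ← mul_add]
  gcongr
  rw [← lintegral_const_mul' _ _ ENNReal.ofReal_ne_top,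
    ← lintegral_const_mul' _ _ ENNReal.ofReal_ne_top, ← lintegral_add_left (by fun_prop)]
  refine lintegral_mono fun r => ?_
  simp only
  rw [← ENNReal.ofReal_mul h0, ← ENNReal.ofReal_mul (sub_nonneg.2 h1),
    ← ENNReal.ofReal_add (by positivity) (mul_nonneg (sub_nonneg.2 h1) (Real.exp_pos _).le)]
  refine ENNReal.ofReal_le_ofReal ?_
  have := convexOn_exp.2 (mem_univ (-(2 * (r : ℝ) * s))) (mem_univ (-(2 * (r : ℝ) * t))) h0
    (sub_nonneg.2 h1) (by ring)
  simp only [smul_eq_mul] at this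
  refine le_trans (le_of_eq ?_) this
  congr 1
  ring

/-- Near the diagonal the weight grows polynomially. -/
theorem weight_toReal_le_of_le_two_mul (hD : Doubling ν R) {t t' : ℝ} (ht : 0 < t) (htt : t ≤ t')
    (ht2 : t' ≤ 2 * t) :
    (weight ν t).toReal ≤ (t' / t) ^ (2 * (R - 1)) * (weight ν t').toReal := by
  have hR := hD.one_le
  have ht' : 0 < t' := ht.trans_le htt
  -- Chosen so that t = θ·t'/2 + (1-θ)·t'. The chord bound is then (1 + θ(R-1)) w(t'), a factor
  -- equal to 1 at t = t'.
  set θ : ℝ := 2 * (1 - t / t') with hθ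
  have hq1 : t / t' ≤ 1 := (div_le_one ht').2 htt
  have hq2 : 1 / 2 ≤ t / t' := by rw [div_le_div_iff₀ two_pos ht']; linarith
  have h0 : 0 ≤ θ := by rw [hθ]; linarith
  have h1 : θ ≤ 1 := by rw [hθ]; linarith
  have e : t = θ * (t' / 2) + (1 - θ) * t' := by rw [hθ]; field_simp; ring
  have h2 : weight ν t ≤ ENNReal.ofReal θ * (ENNReal.ofReal R * weight ν t') +
      ENNReal.ofReal (1 - θ) * weight ν t' := by
    conv_lhs => rw [e]
    refine (weight_convex h0 h1).trans ?_
    gcongr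
    exact hD.weight_le ht'
  have hfin := hD.weight_ne_top ht'
  rw [← mul_assoc, ← add_mul, ← ENNReal.ofReal_mul h0, ← ENNReal.ofReal_add (by positivity)
    (by linarith)] at h2
  have h3 := ENNReal.toReal_mono (ENNReal.mul_ne_top ENNReal.ofReal_ne_top hfin) h2
  rw [ENNReal.toReal_mul, ENNReal.toReal_ofReal (by nlinarith)] at h3
  refine h3.trans (mul_le_mul_of_nonneg_right ?_ ENNReal.toReal_nonneg)
  have hlog : 1 - t / t' ≤ Real.log (t' / t) := by
    have := Real.one_sub_inv_le_log_of_pos (div_pos ht' ht)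
    rwa [inv_div] at this
  calc θ * R + (1 - θ) = θ * (R - 1) + 1 := by ring
    _ ≤ Real.exp (θ * (R - 1)) := Real.add_one_le_exp _
    _ ≤ Real.exp (Real.log (t' / t) * (2 * (R - 1))) := by
        refine Real.exp_le_exp.2 ?_
        rw [hθ]
        nlinarith [mul_le_mul_of_nonneg_right hlog (by linarith : 0 ≤ R - 1)]
    _ = _ := by rw [Real.rpow_def_of_pos (div_pos ht' ht)]

/-- The estimate near the diagonal is a pure power of t'/t, so chaining it over successive doublings
loses nothing. -/
theorem weight_toReal_le (hD : Doubling ν R) {t t' : ℝ} (ht : 0 < t) (htt : t ≤ t') :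
    (weight ν t).toReal ≤ (t' / t) ^ (2 * (R - 1)) * (weight ν t').toReal := by
  obtain ⟨n, hn⟩ := pow_unbounded_of_one_lt (t' / t) (one_lt_two : (1 : ℝ) < 2)
  rw [div_lt_iff₀ ht] at hn
  induction n generalizing t with
  | zero => exact absurd htt (by simpa using hn)
  | succ n ih =>
    rcases le_or_gt t' (2 * t) with h | h
    · exact hD.weight_toReal_le_of_le_two_mul ht htt h
    · have h1 := hD.weight_toReal_le_of_le_two_mul ht (by linarith) (le_refl (2 * t))
      have h2 := ih (t := 2 * t) (by linarith) h.le (by rw [pow_succ] at hn; linarith)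
      refine (h1.trans (mul_le_mul_of_nonneg_left h2 (by positivity))).trans (le_of_eq ?_)
      rw [← mul_assoc, ← Real.mul_rpow (by positivity) (by have := ht.trans_le htt; positivity)]
      congr 2
      field_simp

/-- Quotients of power weights with large negative exponent by the Zen weight are antitone. -/
theorem antitoneOn_div_weight (hD : Doubling ν R) {β : ℝ} (hβ : 2 * (R - 1) ≤ β) :
    AntitoneOn (fun t => t ^ (-β) / (weight ν t).toReal) (Ioi 0) := by
  intro t ht t' ht' htt
  have ht : 0 < t := ht
  have ht' : 0 < t' := ht'
  have hW : ∀ s : ℝ, 0 < s → 0 < (weight ν s).toReal := fun s hs =>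
    ENNReal.toReal_pos (hD.weight_ne_zero hs.le) (hD.weight_ne_top hs)
  simp only
  rw [div_le_div_iff₀ (hW t' ht') (hW t ht)]
  have h1 := hD.weight_toReal_le ht htt
  have h2 : (t' / t) ^ (2 * (R - 1)) ≤ (t' / t) ^ β :=
    Real.rpow_le_rpow_of_exponent_le ((one_le_div ht).2 htt) hβ
  calc t' ^ (-β) * (weight ν t).toReal
      ≤ t' ^ (-β) * ((t' / t) ^ β * (weight ν t').toReal) := by
        gcongr
        exact h1.trans (by gcongr)
    _ = t ^ (-β) * (weight ν t').toReal := by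
        rw [← mul_assoc, Real.div_rpow ht'.le ht.le, Real.rpow_neg ht'.le, Real.rpow_neg ht.le]
        have : t' ^ β ≠ 0 := (Real.rpow_pos_of_pos ht' _).ne'
        field_simp

end Doubling

end Zen

/-! ### The Laplace transform into Zen and Bergman spaces. -/

namespace Zen

variable {ν : Measure ℝ≥0} {R : ℝ} {f : ℝ → ℂ}

theorem lintegral_weightedMeasure {w : ℝ → ℝ≥0∞} (hw : Measurable w) (g : ℝ → ℝ≥0∞)
    (hg : Measurable g) :
    ∫⁻ t, g t ∂weightedMeasure w = ∫⁻ t in Ioi (0 : ℝ), w t * g t := by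
  rw [weightedMeasure, lintegral_withDensity_eq_lintegral_mul _ hw hg]
  rfl

theorem rpow_half_sq (a : ℝ≥0∞) : (a ^ (1 / 2 : ℝ)) ^ 2 = a := by
  rw [← ENNReal.rpow_natCast, ← ENNReal.rpow_mul]
  norm_num

theorem enorm_cexp_neg_mul (t : ℝ) (z : ℂ) :
    ‖Complex.exp (-((t : ℂ) * z))‖ₑ = ENNReal.ofReal (Real.exp (-(t * z.re))) := by
  rw [← ofReal_norm, Complex.norm_exp]
  simp

theorem stronglyMeasurable_laplace (hf : StronglyMeasurable f) :
    StronglyMeasurable (laplace f) := by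
  have h : StronglyMeasurable fun p : ℂ × ℝ => Complex.exp (-((p.2 : ℂ) * p.1)) * f p.2 := by
    refine StronglyMeasurable.mul ?_ (hf.comp_measurable measurable_snd)
    exact (by fun_prop : Continuous fun p : ℂ × ℝ => Complex.exp (-((p.2 : ℂ) * p.1)))
      |>.stronglyMeasurable
  exact h.integral_prod_right' (ν := volume.restrict (Ioi 0))

/-- The function e^{-2t Re z} is at most a constant times w(t), because [0, Re z) has positive mass.
-/
theorem memLp_exp_mul [SFinite ν] (hD : Doubling ν R) (hf : StronglyMeasurable f)
    (hfin : ∫⁻ t, ‖f t‖ₑ ^ 2 ∂weightedMeasure (weight ν) < ∞) {z : ℂ} (hz : 0 < z.re) :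
    MemLp (fun t : ℝ => Complex.exp (-((t : ℂ) * z)) * f t) 2 (volume.restrict (Ioi 0)) := by
  have hexp : Continuous fun t : ℝ => Complex.exp (-((t : ℂ) * z)) := by fun_prop
  refine memLp_two_iff_lintegral.2
    ⟨(hexp.stronglyMeasurable.mul hf).aestronglyMeasurable, ?_⟩
  rw [lintegral_weightedMeasure measurable_weight _ (by fun_prop)] at hfin
  set x : ℝ≥0 := ⟨z.re, hz.le⟩ with hx
  set c : ℝ≥0∞ := ENNReal.ofReal (2 * Real.pi) * ν (Iio x) with hc
  have hc0 : c ≠ 0 := mul_ne_zero (by simp [Real.pi_pos]) (hD.measure_ne_zero x hz)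
  have hc1 : c ≠ ∞ := ENNReal.mul_ne_top ENNReal.ofReal_ne_top (hD.measure_ne_top x)
  have hle : ∀ t ∈ Ioi (0 : ℝ), ‖Complex.exp (-((t : ℂ) * z)) * f t‖ₑ ^ 2 ≤
      c⁻¹ * (weight ν t * ‖f t‖ₑ ^ 2) := by
    intro t ht
    rw [enorm_mul, mul_pow, ← mul_assoc]
    refine mul_le_mul_left ?_ _
    rw [mul_comm c⁻¹, ← div_eq_mul_inv, ENNReal.le_div_iff_mul_le (Or.inl hc0) (Or.inl hc1),
      enorm_cexp_neg_mul, ← ENNReal.ofReal_pow (Real.exp_nonneg _), ← Real.exp_nat_mul]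
    refine le_trans (le_of_eq ?_) (Doubling.le_weight x (le_of_lt ht))
    have : ((2 : ℕ) : ℝ) * -(t * z.re) = -(2 * (x : ℝ) * t) := by
      have hxv : (x : ℝ) = z.re := rfl
      rw [hxv]; push_cast; ring
    rw [this, hc]
    ring
  refine (setLIntegral_mono' measurableSet_Ioi hle).trans_lt ?_
  rw [lintegral_const_mul' _ _ (ENNReal.inv_ne_top.2 hc0)]
  exact ENNReal.mul_lt_top (ENNReal.inv_lt_top.2 (pos_iff_ne_zero.2 hc0)) hfin

/-- Split e^{-tz} into two factors e^{-tz/2} and apply Cauchy–Schwarz. -/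
theorem integrableOn_exp_mul [SFinite ν] (hD : Doubling ν R) (hf : StronglyMeasurable f)
    (hfin : ∫⁻ t, ‖f t‖ₑ ^ 2 ∂weightedMeasure (weight ν) < ∞) {z : ℂ} (hz : 0 < z.re) :
    IntegrableOn (fun t : ℝ => Complex.exp (-((t : ℂ) * z)) * f t) (Ioi 0) := by
  have h1 := memLp_exp_mul hD hf hfin (z := z / 2) (by simpa using hz)
  have h2 : MemLp (fun t : ℝ => Complex.exp (-((t : ℂ) * (z / 2)))) 2
      (volume.restrict (Ioi 0)) := by
    refine (memLp_two_iff_integrable_sq_norm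
      (by fun_prop : Continuous _).aestronglyMeasurable).2 ?_
    refine (exp_neg_integrableOn_Ioi 0 hz).congr_fun (fun t _ => ?_) measurableSet_Ioi
    simp only [Complex.norm_exp, ← Real.exp_nat_mul]
    congr 1
    simp
    ring
  refine (h2.integrable_mul h1).congr (ae_of_all _ fun t => ?_)
  simp only [Pi.mul_apply, ← mul_assoc, ← Complex.exp_add]
  congr 2
  ring

theorem differentiableOn_laplace [SFinite ν] (hD : Doubling ν R) (hf : StronglyMeasurable f)
    (hfin : ∫⁻ t, ‖f t‖ₑ ^ 2 ∂weightedMeasure (weight ν) < ∞) :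
    DifferentiableOn ℂ (laplace f) rightHalfPlane := by
  intro z hz
  have hz : 0 < z.re := hz
  refine DifferentiableAt.differentiableWithinAt ?_
  have hexp : ∀ w : ℂ, Continuous fun t : ℝ => Complex.exp (-((t : ℂ) * w)) := fun w => by fun_prop
  have hid : Continuous fun t : ℝ => -(t : ℂ) := by fun_prop
  -- On the ball of radius Re z/2 one has t e^{-t Re w} ≤ t e^{-t Re z/2}; half of this decay
  -- absorbs the factor t.
  set b : ℝ → ℝ := fun t => 4 / z.re * ‖Complex.exp (-((t : ℂ) * (z / 4))) * f t‖ with hb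
  have key := hasDerivAt_integral_of_dominated_loc_of_deriv_le (μ := volume.restrict (Ioi (0 : ℝ)))
    (F := fun (w : ℂ) (t : ℝ) => Complex.exp (-((t : ℂ) * w)) * f t) (x₀ := z)
    (F' := fun (w : ℂ) (t : ℝ) => (-(t : ℂ) * Complex.exp (-((t : ℂ) * w))) * f t)
    (s := Metric.ball z (z.re / 2)) (bound := b)
    (Metric.ball_mem_nhds z (by linarith))
    (Filter.Eventually.of_forall fun w =>
      ((hexp w).stronglyMeasurable.mul hf).aestronglyMeasurable)
    (integrableOn_exp_mul hD hf hfin hz)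
    (((hid.mul (hexp z)).stronglyMeasurable.mul hf).aestronglyMeasurable)
    ?_ ?_ ?_
  · exact key.2.differentiableAt
  · refine (ae_restrict_iff' measurableSet_Ioi).2 (ae_of_all _ fun t ht w hw => ?_)
    have ht : 0 < t := ht
    have hre : z.re / 2 < w.re := by
      have h1 := (Complex.abs_re_le_norm (w - z)).trans_lt (mem_ball_iff_norm.1 hw)
      rw [Complex.sub_re, abs_lt] at h1
      linarith [h1.1]
    simp only [hb, norm_mul, norm_neg, Complex.norm_real, Complex.norm_exp, ← mul_assoc]
    refine mul_le_mul_of_nonneg_right ?_ (norm_nonneg _)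
    have e1 : (-((t : ℂ) * w)).re = -(t * w.re) := by simp
    have e2 : (-((t : ℂ) * (z / 4))).re = -(t * z.re / 4) := by simp; ring
    rw [e1, e2, Real.norm_of_nonneg ht.le]
    have h3 : t * z.re / 4 ≤ Real.exp (t * z.re / 4) :=
      (by linarith : t * z.re / 4 ≤ t * z.re / 4 + 1).trans (Real.add_one_le_exp _)
    calc t * Real.exp (-(t * w.re))
        ≤ (4 / z.re * Real.exp (t * z.re / 4)) * Real.exp (-(t * (z.re / 2))) := by
          refine mul_le_mul ?_ ?_ (Real.exp_nonneg _) (by positivity)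
          · rw [div_mul_eq_mul_div, le_div_iff₀ hz]
            linarith
          · gcongr
      _ = 4 / z.re * Real.exp (-(t * z.re / 4)) := by
          rw [mul_assoc, ← Real.exp_add]
          congr 2
          ring
  · have hz4 : 0 < (z / 4).re := by simpa using hz
    exact (integrableOn_exp_mul hD hf hfin hz4).norm.const_mul _
  · refine ae_of_all _ fun t w _ => ?_
    have h1 : HasDerivAt (fun w : ℂ => -((t : ℂ) * w)) (-(t : ℂ)) w := by
      have := ((hasDerivAt_id w).const_mul (t : ℂ)).neg
      rw [mul_one] at this
      exact this
    have h2 := h1.cexp.mul_const (f t)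
    rw [mul_comm (Complex.exp _)] at h2
    exact h2

theorem lintegral_vertical_laplace [SFinite ν] (hD : Doubling ν R) (hf : StronglyMeasurable f)
    (hfin : ∫⁻ t, ‖f t‖ₑ ^ 2 ∂weightedMeasure (weight ν) < ∞) {x : ℝ} (hx : 0 < x) :
    ∫⁻ y : ℝ, ‖laplace f ⟨x, y⟩‖ₑ ^ 2 =
      ENNReal.ofReal (2 * Real.pi) *
        ∫⁻ t in Ioi (0 : ℝ), ENNReal.ofReal (Real.exp (-(2 * x * t))) * ‖f t‖ₑ ^ 2 :=
  lintegral_enorm_laplace_sq (integrableOn_exp_mul hD hf hfin (z := x) hx)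
    (memLp_exp_mul hD hf hfin (z := x) hx)

theorem zenNorm_sq (ν : Measure ℝ≥0) (F : ℂ → ℂ) :
    zenNorm ν F ^ 2 = ⨆ ε : ℝ, ⨆ _ : 0 < ε, ∫⁻ z, ‖F (z + (ε : ℂ))‖ₑ ^ 2 ∂(halfPlaneMeasure ν) :=
  rpow_half_sq _

theorem bergmanNorm_sq (α : ℝ) (F : ℂ → ℂ) :
    bergmanNorm α F ^ 2 =
      ∫⁻ z in rightHalfPlane, ENNReal.ofReal (z.re ^ α / Real.pi) * ‖F z‖ₑ ^ 2 :=
  rpow_half_sq _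

theorem measurable_mk : Measurable fun p : ℝ × ℝ => (⟨p.1, p.2⟩ : ℂ) :=
  Complex.measurableEquivRealProd.symm.measurable

theorem lintegral_halfPlaneMeasure [SFinite ν] {G : ℂ → ℝ≥0∞} (hG : Measurable G) :
    ∫⁻ z, G z ∂halfPlaneMeasure ν = ∫⁻ r : ℝ≥0, (∫⁻ y : ℝ, G ⟨r, y⟩) ∂ν := by
  have hm : Measurable fun p : ℝ≥0 × ℝ => (⟨(p.1 : ℝ), p.2⟩ : ℂ) :=
    measurable_mk.comp (by fun_prop : Measurable fun p : ℝ≥0 × ℝ => ((p.1 : ℝ), p.2))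
  rw [halfPlaneMeasure, lintegral_map hG hm, lintegral_prod (fun p : ℝ≥0 × ℝ => G ⟨p.1, p.2⟩)
    (hG.comp hm).aemeasurable]

theorem lintegral_rightHalfPlane {G : ℂ → ℝ≥0∞} (hG : Measurable G) :
    ∫⁻ z in rightHalfPlane, G z = ∫⁻ x in Ioi (0 : ℝ), ∫⁻ y : ℝ, G ⟨x, y⟩ := by
  have hpre : (fun p : ℝ × ℝ => (⟨p.1, p.2⟩ : ℂ)) ⁻¹' rightHalfPlane = Ioi (0 : ℝ) ×ˢ univ := by
    ext p
    simp [rightHalfPlane]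
  rw [← (Complex.volume_preserving_equiv_real_prod.symm).setLIntegral_comp_preimage_emb
    Complex.measurableEquivRealProd.symm.measurableEmbedding]
  change ∫⁻ p in (fun p : ℝ × ℝ => (⟨p.1, p.2⟩ : ℂ)) ⁻¹' rightHalfPlane, G ⟨p.1, p.2⟩ = _
  rw [hpre, Measure.volume_eq_prod, setLIntegral_prod (fun p : ℝ × ℝ => G ⟨p.1, p.2⟩)
    (hG.comp measurable_mk).aemeasurable]
  simp

/-- Apply Plancherel on each line Re = r + ε and swap integrals: the r-integral reassembles w(t),
leaving e^{-2εt} from the shift. -/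
theorem lintegral_halfPlaneMeasure_laplace [SFinite ν] (hD : Doubling ν R)
    (hf : StronglyMeasurable f) (hfin : ∫⁻ t, ‖f t‖ₑ ^ 2 ∂weightedMeasure (weight ν) < ∞)
    {ε : ℝ} (hε : 0 < ε) :
    ∫⁻ z, ‖laplace f (z + (ε : ℂ))‖ₑ ^ 2 ∂(halfPlaneMeasure ν) =
      ∫⁻ t, ENNReal.ofReal (Real.exp (-(2 * ε * t))) * ‖f t‖ₑ ^ 2 ∂weightedMeasure (weight ν) := by
  have hL : Measurable (laplace f) := (stronglyMeasurable_laplace hf).measurable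
  have hfm : Measurable f := hf.measurable
  rw [lintegral_halfPlaneMeasure (by fun_prop)]
  have h1 : ∀ r : ℝ≥0, ∫⁻ y : ℝ, ‖laplace f ((⟨r, y⟩ : ℂ) + (ε : ℂ))‖ₑ ^ 2 =
      ENNReal.ofReal (2 * Real.pi) * ∫⁻ t in Ioi (0 : ℝ),
        ENNReal.ofReal (Real.exp (-(2 * (r + ε) * t))) * ‖f t‖ₑ ^ 2 := by
    intro r
    rw [← lintegral_vertical_laplace hD hf hfin (x := r + ε) (by positivity)]
    refine lintegral_congr fun y => ?_
    have : (⟨r, y⟩ : ℂ) + (ε : ℂ) = ⟨r + ε, y⟩ := by apply Complex.ext <;> simp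
    rw [this]
  simp_rw [h1]
  rw [lintegral_const_mul' _ _ ENNReal.ofReal_ne_top,
    lintegral_lintegral_swap (by fun_prop : Measurable _).aemeasurable,
    ← lintegral_const_mul' _ _ ENNReal.ofReal_ne_top,
    lintegral_weightedMeasure measurable_weight _ (by fun_prop)]
  refine lintegral_congr fun t => ?_
  rw [lintegral_mul_const _ (by fun_prop), weight, ← mul_assoc, ← mul_assoc, mul_assoc _ _
    (ENNReal.ofReal (Real.exp _))]
  congr 2
  rw [← lintegral_mul_const _ (by fun_prop)]
  refine lintegral_congr fun r => ?_
  rw [← ENNReal.ofReal_mul (Real.exp_nonneg _), ← Real.exp_add]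
  congr 2
  ring

/-- The Laplace transform is an isometry into the Zen space. -/
theorem zenNorm_laplace_sq [SFinite ν] (hD : Doubling ν R) (hf : StronglyMeasurable f)
    (hfin : ∫⁻ t, ‖f t‖ₑ ^ 2 ∂weightedMeasure (weight ν) < ∞) :
    zenNorm ν (laplace f) ^ 2 = ∫⁻ t, ‖f t‖ₑ ^ 2 ∂weightedMeasure (weight ν) := by
  have hfm : Measurable f := hf.measurable
  have hpos : ∀ᵐ t ∂weightedMeasure (weight ν), 0 < t :=
    (withDensity_absolutelyContinuous _ _).ae_le (ae_restrict_mem measurableSet_Ioi)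
  rw [zenNorm_sq]
  refine le_antisymm (iSup₂_le fun ε hε => ?_) ?_
  · rw [lintegral_halfPlaneMeasure_laplace hD hf hfin hε]
    refine lintegral_mono_ae ?_
    filter_upwards [hpos] with t ht
    refine mul_le_of_le_one_left' (ENNReal.ofReal_le_one.2 ?_)
    rw [Real.exp_le_one_iff]
    have := mul_pos hε ht
    linarith
  -- Monotone convergence along ε = 1/(n+1) shows that the supremum reaches the unshifted integral.
  · have htend : Filter.Tendsto (fun n : ℕ => ∫⁻ t,
        ENNReal.ofReal (Real.exp (-(2 * (1 / ((n : ℝ) + 1)) * t))) * ‖f t‖ₑ ^ 2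
          ∂weightedMeasure (weight ν)) Filter.atTop
        (nhds (∫⁻ t, ‖f t‖ₑ ^ 2 ∂weightedMeasure (weight ν))) := by
      refine lintegral_tendsto_of_tendsto_of_monotone
        (fun n => (by fun_prop : Measurable _).aemeasurable) ?_ ?_
      · filter_upwards [hpos] with t ht n m hnm
        have := one_div_le_one_div_of_le (by positivity : (0 : ℝ) < n + 1)
          (by exact_mod_cast Nat.succ_le_succ hnm : (n : ℝ) + 1 ≤ m + 1)
        dsimp only
        gcongr
      · refine ae_of_all _ fun t => ?_
        have h0 : Filter.Tendsto (fun n : ℕ => Real.exp (-(2 * (1 / ((n : ℝ) + 1)) * t)))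
            Filter.atTop (nhds 1) := by
          have := ((((tendsto_one_div_add_atTop_nhds_zero_nat (𝕜 := ℝ)).const_mul 2).mul_const
            t).neg).rexp
          simpa using this
        have h1 := ENNReal.Tendsto.mul_const (b := ‖f t‖ₑ ^ 2) (ENNReal.tendsto_ofReal h0)
          (Or.inl (by simp))
        simpa using h1
    refine le_of_tendsto' htend fun n => ?_
    have hn : (0 : ℝ) < 1 / ((n : ℝ) + 1) := by positivity
    rw [← lintegral_halfPlaneMeasure_laplace hD hf hfin hn]
    exact le_iSup₂_of_le (f := fun (ε : ℝ) (_ : 0 < ε) =>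
      ∫⁻ z, ‖laplace f (z + (ε : ℂ))‖ₑ ^ 2 ∂(halfPlaneMeasure ν)) _ hn le_rfl

theorem lintegral_rpow_mul_exp {α t : ℝ} (hα : 0 ≤ α) (ht : 0 < t) :
    ∫⁻ x in Ioi (0 : ℝ), ENNReal.ofReal (x ^ α * Real.exp (-(2 * x * t))) =
      ENNReal.ofReal ((1 / 2) ^ (α + 1) * Real.Gamma (α + 1) * t ^ (-(α + 1))) := by
  have h2t : 0 < 2 * t := by linarith
  have hval := Real.integral_rpow_mul_exp_neg_mul_Ioi (a := α + 1) (by linarith) h2t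
  simp only [add_sub_cancel_right] at hval
  have hrhs : (1 / (2 * t)) ^ (α + 1) * Real.Gamma (α + 1) =
      (1 / 2) ^ (α + 1) * Real.Gamma (α + 1) * t ^ (-(α + 1)) := by
    rw [one_div, mul_inv, Real.mul_rpow (by norm_num) (by positivity), Real.inv_rpow ht.le,
      Real.rpow_neg ht.le, one_div]
    ring
  have hpos : 0 < (1 / (2 * t)) ^ (α + 1) * Real.Gamma (α + 1) :=
    mul_pos (by positivity) (Real.Gamma_pos_of_pos (by linarith))
  -- A nonintegrable function has Bochner integral 0 by convention, so the positive value forces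
  -- integrability.
  have hint : IntegrableOn (fun x : ℝ => x ^ α * Real.exp (-(2 * t * x))) (Ioi 0) := by
    by_contra hcon
    rw [integral_undef hcon] at hval
    exact hpos.ne hval
  rw [← hrhs, ← hval, ofReal_integral_eq_lintegral_ofReal hint]
  · refine lintegral_congr fun x => ?_
    congr 3
    ring
  · exact (ae_restrict_iff' measurableSet_Ioi).2 (ae_of_all _ fun x hx =>
      mul_nonneg (Real.rpow_nonneg (le_of_lt hx) _) (Real.exp_nonneg _))

/-- The constant in the Bergman weight `bergmanConst α * t ^ (-(α + 1))`. -/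
noncomputable def bergmanConst (α : ℝ) : ℝ := 2 * ((1 / 2) ^ (α + 1) * Real.Gamma (α + 1))

theorem bergmanConst_nonneg {α : ℝ} (hα : 0 ≤ α) : 0 ≤ bergmanConst α := by
  have := Real.Gamma_nonneg_of_nonneg (s := α + 1) (by linarith)
  unfold bergmanConst
  positivity

/-- The same Plancherel–Tonelli computation with x^α dx/π in place of dν̃; the inner integral is a
Gamma integral. -/
theorem bergmanNorm_laplace_sq [SFinite ν] (hD : Doubling ν R) (hf : StronglyMeasurable f)
    (hfin : ∫⁻ t, ‖f t‖ₑ ^ 2 ∂weightedMeasure (weight ν) < ∞) {α : ℝ} (hα : 0 ≤ α) :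
    bergmanNorm α (laplace f) ^ 2 = ∫⁻ t in Ioi (0 : ℝ),
      ENNReal.ofReal (bergmanConst α * t ^ (-(α + 1))) * ‖f t‖ₑ ^ 2 := by
  have hL : Measurable (laplace f) := (stronglyMeasurable_laplace hf).measurable
  have hfm : Measurable f := hf.measurable
  rw [bergmanNorm_sq, lintegral_rightHalfPlane (by fun_prop)]
  have h1 : ∀ x ∈ Ioi (0 : ℝ), ∫⁻ y : ℝ, ENNReal.ofReal ((⟨x, y⟩ : ℂ).re ^ α / Real.pi) *
      ‖laplace f ⟨x, y⟩‖ₑ ^ 2 = ∫⁻ t in Ioi (0 : ℝ), ENNReal.ofReal 2 *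
        (ENNReal.ofReal (x ^ α * Real.exp (-(2 * x * t))) * ‖f t‖ₑ ^ 2) := by
    intro x hx
    have hx : 0 < x := hx
    dsimp only
    rw [lintegral_const_mul' _ _ ENNReal.ofReal_ne_top, lintegral_vertical_laplace hD hf hfin hx,
      ← mul_assoc, ← ENNReal.ofReal_mul (by positivity),
      ← lintegral_const_mul' _ _ ENNReal.ofReal_ne_top]
    refine lintegral_congr fun t => ?_
    rw [← mul_assoc, ← mul_assoc (ENNReal.ofReal 2), ← ENNReal.ofReal_mul (by positivity),
      ← ENNReal.ofReal_mul zero_le_two]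
    congr 2
    field_simp
  rw [setLIntegral_congr_fun measurableSet_Ioi h1,
    lintegral_lintegral_swap (by fun_prop : Measurable _).aemeasurable]
  refine setLIntegral_congr_fun measurableSet_Ioi fun t ht => ?_
  rw [lintegral_const_mul' _ _ ENNReal.ofReal_ne_top, lintegral_mul_const _ (by fun_prop),
    lintegral_rpow_mul_exp hα ht, ← mul_assoc, ← ENNReal.ofReal_mul zero_le_two, bergmanConst]
  congr 2
  ring

end Zen

/-! ### Causal operators and decreasing changes of weight. -/

namespace Zen

variable {w : ℝ → ℝ≥0∞} {A : L2 w →ₗ[ℂ] L2 w} {C : ℝ≥0∞}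

theorem weightedMeasure_absolutelyContinuous (w : ℝ → ℝ≥0∞) :
    weightedMeasure w ≪ volume.restrict (Ioi 0) :=
  withDensity_absolutelyContinuous _ _

theorem ae_weightedMeasure_pos (w : ℝ → ℝ≥0∞) : ∀ᵐ t ∂weightedMeasure w, 0 < t :=
  (weightedMeasure_absolutelyContinuous w).ae_le (ae_restrict_mem measurableSet_Ioi)

/-- Truncating f to (0, T] does not change Af there, so the global bound can be applied to the
truncation. -/
theorem IsCausal.setLIntegral_Iic_le (hA : IsCausal A)
    (hC : ∀ f, ∫⁻ t, ‖A f t‖ₑ ^ 2 ∂weightedMeasure w ≤ C * ∫⁻ t, ‖f t‖ₑ ^ 2 ∂weightedMeasure w)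
    {T : ℝ} (hT : 0 < T) (f : L2 w) :
    ∫⁻ t in Iic T, ‖A f t‖ₑ ^ 2 ∂weightedMeasure w ≤
      C * ∫⁻ t in Iic T, ‖f t‖ₑ ^ 2 ∂weightedMeasure w := by
  have hmem : MemLp ((Iic T).indicator f) 2 (weightedMeasure w) :=
    (Lp.memLp f).indicator measurableSet_Iic
  set g : L2 w := hmem.toLp _ with hg
  have hgf : g =ᵐ[weightedMeasure w] (Iic T).indicator f := hmem.coeFn_toLp
  have hvan : ∀ᵐ t ∂weightedMeasure w, t ≤ T → (f - g) t = 0 := by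
    filter_upwards [Lp.coeFn_sub f g, hgf] with t h1 h2 ht
    rw [h1, Pi.sub_apply, h2, indicator_of_mem (mem_Iic.2 ht), sub_self]
  have hAe : ∀ᵐ t ∂weightedMeasure w, t ∈ Iic T → ‖A f t‖ₑ ^ 2 = ‖A g t‖ₑ ^ 2 := by
    have h3 := hA T hT _ hvan
    rw [map_sub] at h3
    filter_upwards [h3, Lp.coeFn_sub (A f) (A g)] with t h1 h2 ht
    rw [h2, Pi.sub_apply] at h1
    rw [sub_eq_zero.1 (h1 ht)]
  calc ∫⁻ t in Iic T, ‖A f t‖ₑ ^ 2 ∂weightedMeasure w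
      = ∫⁻ t in Iic T, ‖A g t‖ₑ ^ 2 ∂weightedMeasure w :=
        setLIntegral_congr_fun_ae measurableSet_Iic hAe
    _ ≤ ∫⁻ t, ‖A g t‖ₑ ^ 2 ∂weightedMeasure w := setLIntegral_le_lintegral _ _
    _ ≤ C * ∫⁻ t, ‖g t‖ₑ ^ 2 ∂weightedMeasure w := hC g
    _ = C * ∫⁻ t in Iic T, ‖f t‖ₑ ^ 2 ∂weightedMeasure w := by
        rw [← lintegral_indicator measurableSet_Iic]
        congr 1
        refine lintegral_congr_ae ?_
        filter_upwards [hgf] with t ht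
        rw [ht]
        by_cases h : t ∈ Iic T <;> simp [h]

/-- Up to a null set, a superlevel set of a decreasing function on (0, ∞) is empty, everything, or
some (0, T]. -/
theorem IsCausal.setLIntegral_superlevel_le (hA : IsCausal A)
    (hC : ∀ f, ∫⁻ t, ‖A f t‖ₑ ^ 2 ∂weightedMeasure w ≤ C * ∫⁻ t, ‖f t‖ₑ ^ 2 ∂weightedMeasure w)
    {u : ℝ → ℝ} (hu : AntitoneOn u (Ioi 0)) (σ : ℝ) (f : L2 w) :
    ∫⁻ t in {t | σ < u t}, ‖A f t‖ₑ ^ 2 ∂weightedMeasure w ≤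
      C * ∫⁻ t in {t | σ < u t}, ‖f t‖ₑ ^ 2 ∂weightedMeasure w := by
  set I : Set ℝ := {t | 0 < t ∧ σ < u t} with hI
  have hdown : ∀ t ∈ I, ∀ s, 0 < s → s ≤ t → s ∈ I := fun t ht s hs hst =>
    ⟨hs, ht.2.trans_le (hu hs ht.1 hst)⟩
  have hpos := ae_weightedMeasure_pos w
  by_cases hne : I.Nonempty
  · by_cases hb : BddAbove I
    · have hT : 0 < sSup I := hne.some_mem.1.trans_le (le_csSup hb hne.some_mem)
      -- Whether the endpoint belongs to the interval is immaterial.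
      have hs : ∀ᵐ t ∂weightedMeasure w, t ≠ sSup I :=
        ((weightedMeasure_absolutelyContinuous w).trans
          Measure.absolutelyContinuous_restrict).ae_le (Measure.ae_ne volume _)
      have hset : ({t | σ < u t} : Set ℝ) =ᵐ[weightedMeasure w] Iic (sSup I) := by
        filter_upwards [hpos, hs] with t ht hts
        refine propext ⟨fun h => le_csSup hb ⟨ht, h⟩, fun h => ?_⟩
        obtain ⟨t', ht', hlt⟩ := exists_lt_of_lt_csSup hne (lt_of_le_of_ne h hts)
        exact (hdown t' ht' t ht hlt.le).2
      rw [setLIntegral_congr hset, setLIntegral_congr hset]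
      exact hA.setLIntegral_Iic_le hC hT f
    · have hset : ({t | σ < u t} : Set ℝ) =ᵐ[weightedMeasure w] univ := by
        filter_upwards [hpos] with t ht
        refine propext ⟨fun _ => mem_univ t, fun _ => ?_⟩
        obtain ⟨t', ht', hlt⟩ := not_bddAbove_iff.1 hb t
        exact (hdown t' ht' t ht hlt.le).2
      rw [setLIntegral_congr hset, setLIntegral_congr hset, setLIntegral_univ, setLIntegral_univ]
      exact hC f
  · have hset : ({t | σ < u t} : Set ℝ) =ᵐ[weightedMeasure w] (∅ : Set ℝ) := by
      filter_upwards [hpos] with t ht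
      exact propext ⟨fun h => (hne ⟨t, ht, h⟩).elim, fun h => h.elim⟩
    rw [setLIntegral_congr hset]
    simp

/-- The layer-cake formula for u with respect to the measure |f|² w dt. -/
theorem lintegral_mul_eq_lintegral_superlevel {u : ℝ → ℝ} (hum : Measurable u)
    (hu0 : ∀ t, 0 < t → 0 ≤ u t) (f : L2 w) :
    ∫⁻ t, ENNReal.ofReal (u t) * ‖f t‖ₑ ^ 2 ∂weightedMeasure w =
      ∫⁻ σ in Ioi 0, ∫⁻ t in {t | σ < u t}, ‖f t‖ₑ ^ 2 ∂weightedMeasure w := by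
  have hf : Measurable fun t => ‖f t‖ₑ ^ 2 := by
    have := (Lp.stronglyMeasurable f).measurable
    fun_prop
  have hac : (weightedMeasure w).withDensity (fun t => ‖f t‖ₑ ^ 2) ≪ weightedMeasure w :=
    withDensity_absolutelyContinuous _ _
  have h1 := lintegral_withDensity_eq_lintegral_mul (weightedMeasure w) hf hum.ennreal_ofReal
  simp only [Pi.mul_apply] at h1
  simp_rw [mul_comm (ENNReal.ofReal _)]
  rw [← h1, lintegral_eq_lintegral_meas_lt _
    (hac.ae_le ((ae_weightedMeasure_pos w).mono hu0)) hum.aemeasurable]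
  exact lintegral_congr fun σ => withDensity_apply _ (measurableSet_lt measurable_const hum)

/-- A causal operator on a weighted `L²` space does not increase its norm when the weight is
multiplied by a decreasing function. -/
theorem IsCausal.lintegral_mul_le (hA : IsCausal A) (hCtop : C ≠ ∞)
    (hC : ∀ f, ∫⁻ t, ‖A f t‖ₑ ^ 2 ∂weightedMeasure w ≤ C * ∫⁻ t, ‖f t‖ₑ ^ 2 ∂weightedMeasure w)
    {u : ℝ → ℝ} (hum : Measurable u) (hu : AntitoneOn u (Ioi 0)) (hu0 : ∀ t, 0 < t → 0 ≤ u t)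
    (f : L2 w) :
    ∫⁻ t, ENNReal.ofReal (u t) * ‖A f t‖ₑ ^ 2 ∂weightedMeasure w ≤
      C * ∫⁻ t, ENNReal.ofReal (u t) * ‖f t‖ₑ ^ 2 ∂weightedMeasure w := by
  rw [lintegral_mul_eq_lintegral_superlevel hum hu0, lintegral_mul_eq_lintegral_superlevel hum hu0,
    ← lintegral_const_mul' _ _ hCtop]
  exact lintegral_mono fun σ => hA.setLIntegral_superlevel_le hC hu σ f

end Zen

/-! ### Point evaluations and regularization. -/

namespace Zen

variable {ν : Measure ℝ≥0} {R : ℝ} {F G : ℂ → ℂ}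

theorem isOpen_rightHalfPlane : IsOpen rightHalfPlane :=
  isOpen_lt continuous_const Complex.continuous_re

theorem measurableSet_rightHalfPlane : MeasurableSet rightHalfPlane :=
  isOpen_rightHalfPlane.measurableSet

theorem ae_halfPlaneMeasure_re_nonneg (ν : Measure ℝ≥0) :
    ∀ᵐ z ∂halfPlaneMeasure ν, 0 ≤ z.re := by
  have hm : Measurable fun p : ℝ≥0 × ℝ => (⟨(p.1 : ℝ), p.2⟩ : ℂ) :=
    measurable_mk.comp (by fun_prop : Measurable fun p : ℝ≥0 × ℝ => ((p.1 : ℝ), p.2))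
  rw [halfPlaneMeasure, ae_map_iff hm.aemeasurable
    (measurableSet_le measurable_const Complex.measurable_re)]
  exact ae_of_all _ fun p => p.1.coe_nonneg

theorem add_ofReal_mem {z : ℂ} (hz : 0 ≤ z.re) {ε : ℝ} (hε : 0 < ε) :
    z + (ε : ℂ) ∈ rightHalfPlane := by
  change 0 < (z + (ε : ℂ)).re
  rw [Complex.add_re, Complex.ofReal_re]
  linarith

theorem zenNorm_congr (ν : Measure ℝ≥0) (h : EqOn F G rightHalfPlane) :
    zenNorm ν F = zenNorm ν G := by
  unfold zenNorm
  congr 1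
  refine iSup_congr fun ε => iSup_congr fun hε => lintegral_congr_ae ?_
  filter_upwards [ae_halfPlaneMeasure_re_nonneg ν] with z hz
  rw [h (add_ofReal_mem hz hε)]

theorem bergmanNorm_congr (α : ℝ) (h : EqOn F G rightHalfPlane) :
    bergmanNorm α F = bergmanNorm α G := by
  unfold bergmanNorm
  congr 1
  exact setLIntegral_congr_fun measurableSet_rightHalfPlane fun z hz => by
    simp only [h hz]

/-- The sub-mean value property of `|F|²` on circles. -/
theorem enorm_sq_mul_le_lintegral_circle {z : ℂ} {ρ δ : ℝ} (hρ : 0 < ρ) (hρδ : ρ < δ)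
    (hF : DifferentiableOn ℂ F (Metric.ball z δ)) :
    ENNReal.ofReal (2 * Real.pi) * ‖F z‖ₑ ^ 2 ≤
      ∫⁻ θ in Ioo (-Real.pi) Real.pi, ‖F (z + Complex.polarCoord.symm (ρ, θ))‖ₑ ^ 2 := by
  have hsub : Metric.closedBall z |ρ| ⊆ Metric.ball z δ := by
    rw [abs_of_pos hρ]
    exact Metric.closedBall_subset_ball hρδ
  -- The square F² is itself analytic, so its mean value property replaces subharmonicity of |F|².
  have hF2 : DifferentiableOn ℂ (fun w => F w ^ 2) (Metric.closedBall z |ρ|) :=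
    (hF.mono hsub).pow 2
  have hmean := (hF2.diffContOnCl_ball (le_refl _)).circleAverage
  have h2pi : (0 : ℝ) < 2 * Real.pi := by positivity
  have hper : ∫ θ in (0 : ℝ)..2 * Real.pi, F (circleMap z ρ θ) ^ 2 =
      ∫ θ in (-Real.pi)..Real.pi, F (circleMap z ρ θ) ^ 2 := by
    have hp : Function.Periodic (fun θ => F (circleMap z ρ θ) ^ 2) (2 * Real.pi) := fun θ => by
      simp only [periodic_circleMap z ρ θ]
    have := hp.intervalIntegral_add_eq 0 (-Real.pi)
    rw [zero_add] at this
    rw [this]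
    congr 1
    ring
  rw [Real.circleAverage, hper, intervalIntegral.integral_of_le (by linarith [Real.pi_pos])]
    at hmean
  have hval : (2 * Real.pi) • F z ^ 2 =
      ∫ θ in Ioc (-Real.pi) Real.pi, F (circleMap z ρ θ) ^ 2 := by
    rw [← hmean, smul_smul, mul_inv_cancel₀ h2pi.ne', one_smul]
  calc ENNReal.ofReal (2 * Real.pi) * ‖F z‖ₑ ^ 2 = ‖(2 * Real.pi) • F z ^ 2‖ₑ := by
        rw [enorm_smul, enorm_pow, Real.enorm_of_nonneg h2pi.le]
    _ ≤ ∫⁻ θ in Ioc (-Real.pi) Real.pi, ‖F (circleMap z ρ θ) ^ 2‖ₑ := by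
        rw [hval]
        exact enorm_integral_le_lintegral_enorm _
    _ = ∫⁻ θ in Ioo (-Real.pi) Real.pi, ‖F (z + Complex.polarCoord.symm (ρ, θ))‖ₑ ^ 2 := by
        rw [setLIntegral_congr Ioo_ae_eq_Ioc.symm]
        refine lintegral_congr fun θ => ?_
        rw [enorm_pow, circleMap, Complex.polarCoord_symm_apply, Complex.exp_mul_I]
        simp

/-- Point evaluations are controlled by the area integral of `|F|²` over a disc. -/
theorem enorm_sq_mul_le_lintegral_ball {z : ℂ} {δ : ℝ} (hδ : 0 < δ) (hFm : Measurable F)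
    (hF : DifferentiableOn ℂ F (Metric.ball z δ)) :
    ENNReal.ofReal (Real.pi * δ ^ 2 / 2) * ‖F z‖ₑ ^ 2 ≤
      ∫⁻ w in Metric.ball z δ, ‖F w‖ₑ ^ 2 := by
  set H : ℂ → ℝ≥0∞ := (Metric.ball z δ).indicator fun w => ‖F w‖ₑ ^ 2 with hH
  have hHm : Measurable H := (hFm.enorm.pow_const 2).indicator Metric.isOpen_ball.measurableSet
  rw [← lintegral_indicator Metric.isOpen_ball.measurableSet, ← hH,
    ← lintegral_add_left_eq_self H z, ← Complex.lintegral_comp_polarCoord_symm,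
    polarCoord_target, Measure.volume_eq_prod, setLIntegral_prod]
  swap
  · have hp : Measurable fun p : ℝ × ℝ => Complex.polarCoord.symm p := by
      simp only [Complex.polarCoord_symm_apply]
      fun_prop
    simp only [smul_eq_mul]
    exact (by fun_prop : Measurable _).aemeasurable
  -- Only radii above δ/2 are kept: there the polar Jacobian is at least δ/2, giving (δ/2)(δ/2)(2π)
  -- = πδ²/2.
  have hsub : Ioo (δ / 2) δ ⊆ Ioi (0 : ℝ) := fun ρ hρ => (by linarith [hρ.1] : (0 : ℝ) < ρ)
  refine le_trans ?_ (lintegral_mono_set hsub)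
  have hconst : ENNReal.ofReal (Real.pi * δ ^ 2 / 2) * ‖F z‖ₑ ^ 2 =
      ∫⁻ _ in Ioo (δ / 2) δ, ENNReal.ofReal (δ / 2) * (ENNReal.ofReal (2 * Real.pi) * ‖F z‖ₑ ^ 2)
      := by
    have hpi := Real.pi_pos
    rw [setLIntegral_const, Real.volume_Ioo, sub_half, mul_right_comm, ← mul_assoc,
      ← ENNReal.ofReal_mul (by positivity), ← ENNReal.ofReal_mul (by positivity)]
    congr 2
    ring
  rw [hconst]
  refine setLIntegral_mono' measurableSet_Ioo fun ρ hρ => ?_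
  have hρ0 : 0 < ρ := hsub hρ
  simp only [smul_eq_mul]
  rw [lintegral_const_mul' _ _ ENNReal.ofReal_ne_top]
  refine mul_le_mul' (ENNReal.ofReal_le_ofReal hρ.1.le) ?_
  refine (enorm_sq_mul_le_lintegral_circle hρ0 hρ.2 hF).trans (le_of_eq ?_)
  refine lintegral_congr fun θ => ?_
  rw [hH, indicator_of_mem]
  rw [mem_ball_iff_norm, add_sub_cancel_left, Complex.norm_polarCoord_symm, abs_of_pos hρ0]
  exact hρ.2

/-- Functions in the Bergman space are bounded on smaller half-planes. -/
theorem exists_bound_of_bergmanNorm {α : ℝ} (hα : 0 ≤ α) (hFm : Measurable F)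
    (hF : DifferentiableOn ℂ F rightHalfPlane) (hfin : bergmanNorm α F < ∞) {ε : ℝ}
    (hε : 0 < ε) : ∃ M : ℝ≥0∞, M ≠ ∞ ∧ ∀ z : ℂ, ε ≤ z.re → ‖F z‖ₑ ^ 2 ≤ M := by
  set δ := ε / 2 with hδ
  have hδ0 : 0 < δ := by positivity
  set c := ENNReal.ofReal (Real.pi * δ ^ 2 / 2) with hc
  set d := ENNReal.ofReal (δ ^ α / Real.pi) with hd
  have hc0 : c ≠ 0 := by simp only [hc, ne_eq, ENNReal.ofReal_eq_zero, not_le]; positivity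
  have hd0 : d ≠ 0 := by simp only [hd, ne_eq, ENNReal.ofReal_eq_zero, not_le]; positivity
  refine ⟨bergmanNorm α F ^ 2 / (d * c),
    ENNReal.div_ne_top (ENNReal.pow_ne_top hfin.ne) (mul_ne_zero hd0 hc0), fun z hz => ?_⟩
  have hre : ∀ w ∈ Metric.ball z δ, δ ≤ w.re := fun w hw => by
    have h1 := (Complex.abs_re_le_norm (w - z)).trans_lt (mem_ball_iff_norm.1 hw)
    rw [Complex.sub_re, abs_lt] at h1
    linarith [h1.1]
  have hsub : Metric.ball z δ ⊆ rightHalfPlane := fun w hw => hδ0.trans_le (hre w hw)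
  rw [ENNReal.le_div_iff_mul_le (Or.inl (mul_ne_zero hd0 hc0))
    (Or.inl (ENNReal.mul_ne_top ENNReal.ofReal_ne_top ENNReal.ofReal_ne_top)), mul_comm, mul_assoc,
    bergmanNorm_sq]
  calc d * (c * ‖F z‖ₑ ^ 2) ≤ d * ∫⁻ w in Metric.ball z δ, ‖F w‖ₑ ^ 2 := by
        gcongr
        exact enorm_sq_mul_le_lintegral_ball hδ0 hFm (hF.mono hsub)
    _ = ∫⁻ w in Metric.ball z δ, d * ‖F w‖ₑ ^ 2 :=
        (lintegral_const_mul' _ _ ENNReal.ofReal_ne_top).symm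
    _ ≤ ∫⁻ w in Metric.ball z δ, ENNReal.ofReal (w.re ^ α / Real.pi) * ‖F w‖ₑ ^ 2 := by
        refine setLIntegral_mono' Metric.isOpen_ball.measurableSet fun w hw => ?_
        have := hre w hw
        rw [hd]
        gcongr
    _ ≤ _ := lintegral_mono_set hsub

/-- A regularization of a function on the right half-plane. -/
noncomputable def regularize (F : ℂ → ℂ) (ε : ℝ) (z : ℂ) : ℂ :=
  F (z + ε) * (Complex.exp (-(ε * z)) / (1 + ε * z))

theorem normSq_one_add_mul_le {ε : ℝ} (hε : 0 < ε) {z : ℂ} (hz : 0 ≤ z.re) :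
    1 + (ε * z.im) ^ 2 ≤ ‖1 + (ε : ℂ) * z‖ ^ 2 := by
  rw [← Complex.normSq_eq_norm_sq, Complex.normSq_apply]
  have := mul_nonneg hε.le hz
  simp
  nlinarith

theorem enorm_regularizer_sq_le {ε : ℝ} (hε : 0 < ε) {z : ℂ} (hz : 0 ≤ z.re) :
    ‖Complex.exp (-(ε * z)) / (1 + ε * z)‖ₑ ^ 2 ≤
      ENNReal.ofReal (Real.exp (-(2 * z.re * ε))) * ENNReal.ofReal (1 + (ε * z.im) ^ 2)⁻¹ := by
  rw [← ofReal_norm, ← ENNReal.ofReal_pow (norm_nonneg _), ← ENNReal.ofReal_mul (Real.exp_nonneg _),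
    norm_div, div_pow, Complex.norm_exp, ← Real.exp_nat_mul, div_eq_mul_inv]
  refine ENNReal.ofReal_le_ofReal (mul_le_mul (le_of_eq ?_) ?_ (by positivity) (by positivity))
  · congr 1
    simp
    ring
  · exact inv_anti₀ (by positivity) (normSq_one_add_mul_le hε hz)

theorem enorm_regularize_sq_le {ε : ℝ} (hε : 0 < ε) {z : ℂ} (hz : 0 ≤ z.re) :
    ‖regularize F ε z‖ₑ ^ 2 ≤ ‖F (z + ε)‖ₑ ^ 2 := by
  rw [regularize, enorm_mul, mul_pow]
  refine mul_le_of_le_one_right' ((enorm_regularizer_sq_le hε hz).trans ?_)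
  refine mul_le_one' (ENNReal.ofReal_le_one.2 ?_) (ENNReal.ofReal_le_one.2 ?_)
  · rw [Real.exp_le_one_iff]
    have := mul_nonneg hz hε.le
    linarith
  · exact inv_le_one_of_one_le₀ (by have := sq_nonneg (ε * z.im); linarith)

theorem differentiableOn_regularize (hF : DifferentiableOn ℂ F rightHalfPlane) {ε : ℝ}
    (hε : 0 < ε) : DifferentiableOn ℂ (regularize F ε) rightHalfPlane := by
  refine DifferentiableOn.mul ?_ (DifferentiableOn.div (by fun_prop) (by fun_prop) ?_)
  · exact hF.comp (by fun_prop) fun z hz => add_ofReal_mem (le_of_lt hz) hε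
  · intro z hz h0
    have := normSq_one_add_mul_le hε (le_of_lt hz)
    rw [h0] at this
    have h2 := sq_nonneg (ε * z.im)
    simp at this
    linarith

/-- The multiplier has modulus at most 1, and for α ≥ 0 the shift to the right only increases (Re
z)^α. -/
theorem bergmanNorm_regularize_le {α : ℝ} (hα : 0 ≤ α) {ε : ℝ} (hε : 0 < ε) :
    bergmanNorm α (regularize F ε) ≤ bergmanNorm α F := by
  unfold bergmanNorm
  refine ENNReal.rpow_le_rpow ?_ (by norm_num)
  set H : ℂ → ℝ≥0∞ := rightHalfPlane.indicator
    fun z => ENNReal.ofReal (z.re ^ α / Real.pi) * ‖F z‖ₑ ^ 2 with hH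
  rw [← lintegral_indicator measurableSet_rightHalfPlane,
    ← lintegral_indicator measurableSet_rightHalfPlane, ← hH,
    ← lintegral_add_right_eq_self H (ε : ℂ)]
  refine lintegral_mono fun z => ?_
  by_cases hz : z ∈ rightHalfPlane
  · have hz0 : 0 ≤ z.re := le_of_lt hz
    rw [indicator_of_mem hz, hH, indicator_of_mem (add_ofReal_mem hz0 hε)]
    refine mul_le_mul' (ENNReal.ofReal_le_ofReal ?_) (enorm_regularize_sq_le hε hz0)
    have : z.re ≤ (z + (ε : ℂ)).re := by simp [hε.le]
    gcongr
  · rw [indicator_of_notMem hz]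
    exact zero_le

/-- Each factor has its task: the shift makes F bounded, e^{-εz} makes the integral against ν̃
finite because w(ε) is, and 1/(1+εz) gives square integrability along vertical lines. -/
theorem zenNorm_regularize_lt_top [SFinite ν] (hD : Doubling ν R) {α : ℝ} (hα : 0 ≤ α)
    (hFm : Measurable F) (hF : DifferentiableOn ℂ F rightHalfPlane)
    (hfin : bergmanNorm α F < ∞) {ε : ℝ} (hε : 0 < ε) : zenNorm ν (regularize F ε) < ∞ := by
  obtain ⟨M, hM, hbound⟩ := exists_bound_of_bergmanNorm hα hFm hF hfin hε
  set b : ℂ → ℝ≥0∞ := fun z =>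
    ENNReal.ofReal (Real.exp (-(2 * z.re * ε))) * ENNReal.ofReal (1 + (ε * z.im) ^ 2)⁻¹ with hb
  have hbm : Measurable b := by
    have := Complex.measurable_re
    have := Complex.measurable_im
    fun_prop
  have hw : ∫⁻ r : ℝ≥0, ENNReal.ofReal (Real.exp (-(2 * (r : ℝ) * ε))) ∂ν ≠ ∞ := by
    have := hD.weight_ne_top hε
    rw [weight] at this
    intro htop
    rw [htop, ENNReal.mul_top (by simp [Real.pi_pos])] at this
    exact this rfl
  have hc : ∫⁻ y : ℝ, ENNReal.ofReal (1 + (ε * y) ^ 2)⁻¹ ≠ ∞ :=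
    (integrable_inv_one_add_sq.comp_mul_left' hε.ne').lintegral_lt_top.ne
  have hbfin : ∫⁻ z, M * b z ∂halfPlaneMeasure ν ≠ ∞ := by
    rw [lintegral_const_mul' _ _ hM, lintegral_halfPlaneMeasure hbm]
    refine ENNReal.mul_ne_top hM ?_
    simp only [hb]
    simp_rw [lintegral_const_mul' _ _ ENNReal.ofReal_ne_top]
    rw [lintegral_mul_const' _ _ hc]
    exact ENNReal.mul_ne_top hw hc
  refine (ENNReal.pow_lt_top_iff (n := 2)).1 ?_ |>.resolve_right two_ne_zero
  rw [zenNorm_sq]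
  refine lt_of_le_of_lt (iSup₂_le fun δ hδ => lintegral_mono_ae ?_) hbfin.lt_top
  filter_upwards [ae_halfPlaneMeasure_re_nonneg ν] with z hz
  have hzδ : 0 ≤ (z + (δ : ℂ)).re := le_of_lt (add_ofReal_mem hz hδ)
  rw [regularize, enorm_mul, mul_pow]
  refine mul_le_mul' (hbound _ ?_) ((enorm_regularizer_sq_le hε hzδ).trans ?_)
  · rw [Complex.add_re, Complex.ofReal_re]
    linarith
  · have h1 : z.re ≤ (z + (δ : ℂ)).re := by simp [hδ.le]
    have h2 : (z + (δ : ℂ)).im = z.im := by simp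
    simp only [hb, h2]
    gcongr

theorem tendsto_regularize (hF : DifferentiableOn ℂ F rightHalfPlane) {z : ℂ}
    (hz : z ∈ rightHalfPlane) :
    Filter.Tendsto (fun n : ℕ => regularize F (1 / ((n : ℝ) + 1)) z) Filter.atTop (nhds (F z)) := by
  have hc : ContinuousAt F z :=
    (hF.differentiableAt (isOpen_rightHalfPlane.mem_nhds hz)).continuousAt
  have h1 : ContinuousAt (fun ε : ℝ => regularize F ε z) 0 := by
    unfold regularize
    refine ContinuousAt.mul ?_ (ContinuousAt.div (by fun_prop) (by fun_prop) (by simp))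
    exact ContinuousAt.comp (f := fun ε : ℝ => z + (ε : ℂ)) (by simpa using hc) (by fun_prop)
  have h2 := h1.tendsto.comp (tendsto_one_div_add_atTop_nhds_zero_nat (𝕜 := ℝ))
  simpa [regularize, Function.comp_def] using h2

end Zen

/-! ### Transfer of the norm bound from Zen to Bergman spaces. -/

namespace Zen

variable {ν : Measure ℝ≥0} {R : ℝ} {h φ : ℂ → ℂ} {C : ℝ≥0∞}

theorem lintegral_L2_lt_top {w : ℝ → ℝ≥0∞} (f : L2 w) :
    ∫⁻ t, ‖f t‖ₑ ^ 2 ∂weightedMeasure w < ∞ :=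
  (memLp_two_iff_lintegral.1 (Lp.memLp f)).2

theorem weightedComp_congr (hmaps : MapsTo φ rightHalfPlane rightHalfPlane) {F G : ℂ → ℂ}
    (hFG : EqOn F G rightHalfPlane) :
    EqOn (weightedComp h φ F) (weightedComp h φ G) rightHalfPlane := fun z hz => by
  simp only [weightedComp, hFG (hmaps hz)]

theorem laplace_mem_zenSpace [SFinite ν] (hD : Doubling ν R) (f : L2 (weight ν)) :
    laplace f ∈ zenSpace ν := by
  refine ⟨differentiableOn_laplace hD (Lp.stronglyMeasurable f) (lintegral_L2_lt_top f), ?_⟩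
  refine (ENNReal.pow_lt_top_iff (n := 2)).1 ?_ |>.resolve_right two_ne_zero
  rw [zenNorm_laplace_sq hD (Lp.stronglyMeasurable f) (lintegral_L2_lt_top f)]
  exact lintegral_L2_lt_top f

/-- The Bergman norm of a Laplace transform as an integral against the Zen weight. -/
theorem bergmanNorm_laplace_sq_eq_weighted [SFinite ν] (hD : Doubling ν R) (f : L2 (weight ν))
    {α : ℝ} (hα : 0 ≤ α) :
    bergmanNorm α (laplace f) ^ 2 = ENNReal.ofReal (bergmanConst α) *
      ∫⁻ t, ENNReal.ofReal (t ^ (-(α + 1)) / (weight ν t).toReal) * ‖f t‖ₑ ^ 2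
        ∂weightedMeasure (weight ν) := by
  have hfm : Measurable f := (Lp.stronglyMeasurable f).measurable
  have hwm : Measurable (weight ν) := measurable_weight
  rw [bergmanNorm_laplace_sq hD (Lp.stronglyMeasurable f) (lintegral_L2_lt_top f) hα,
    lintegral_weightedMeasure hwm _ (by fun_prop), ← lintegral_const_mul' _ _ ENNReal.ofReal_ne_top]
  refine setLIntegral_congr_fun measurableSet_Ioi fun t ht => ?_
  have ht : 0 < t := ht
  have hW : 0 < (weight ν t).toReal :=
    ENNReal.toReal_pos (hD.weight_ne_zero ht.le) (hD.weight_ne_top ht)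
  conv_rhs => rw [← ENNReal.ofReal_toReal (hD.weight_ne_top ht)]
  rw [ENNReal.toReal_ofReal hW.le, ← mul_assoc (ENNReal.ofReal (weight ν t).toReal),
    ← ENNReal.ofReal_mul hW.le, mul_div_cancel₀ _ hW.ne', ← mul_assoc,
    ← ENNReal.ofReal_mul (bergmanConst_nonneg hα)]

theorem lintegral_causal_le [SFinite ν] (hD : Doubling ν R)
    (hC : ∀ F ∈ zenSpace ν, zenNorm ν (weightedComp h φ F) ≤ C * zenNorm ν F)
    {A : L2 (weight ν) →ₗ[ℂ] L2 (weight ν)}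
    (hA : ∀ f : L2 (weight ν),
      EqOn (laplace (A f)) (weightedComp h φ (laplace f)) rightHalfPlane) (f : L2 (weight ν)) :
    ∫⁻ t, ‖A f t‖ₑ ^ 2 ∂weightedMeasure (weight ν) ≤
      C ^ 2 * ∫⁻ t, ‖f t‖ₑ ^ 2 ∂weightedMeasure (weight ν) := by
  rw [← zenNorm_laplace_sq hD (Lp.stronglyMeasurable f) (lintegral_L2_lt_top f),
    ← zenNorm_laplace_sq hD (Lp.stronglyMeasurable (A f)) (lintegral_L2_lt_top (A f)),
    zenNorm_congr ν (hA f), ← mul_pow]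
  gcongr
  exact hC _ (laplace_mem_zenSpace hD f)

/-- On functions in the Zen space, the Bergman norm bound follows from causality. -/
theorem bergmanNorm_weightedComp_le_of_mem_zenSpace [SFinite ν] (hD : Doubling ν R)
    (hL : LaplaceSurjective ν) (hmaps : MapsTo φ rightHalfPlane rightHalfPlane) (hCtop : C ≠ ∞)
    (hC : ∀ F ∈ zenSpace ν, zenNorm ν (weightedComp h φ F) ≤ C * zenNorm ν F)
    (hcausal : IsCausalOnZen ν (weightedComp h φ)) {α : ℝ} (hα : 0 ≤ α)
    (hαR : 2 * (R - 1) ≤ α) {G : ℂ → ℂ} (hG : G ∈ zenSpace ν) :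
    bergmanNorm α (weightedComp h φ G) ≤ C * bergmanNorm α G := by
  obtain ⟨A, hA, hcaus⟩ := hcausal
  obtain ⟨f, hf⟩ := hL G hG
  rw [← bergmanNorm_congr α hf, ← bergmanNorm_congr α (weightedComp_congr hmaps hf),
    ← bergmanNorm_congr α (hA f)]
  refine (ENNReal.pow_le_pow_left_iff two_ne_zero).1 ?_
  rw [mul_pow, bergmanNorm_laplace_sq_eq_weighted hD _ hα,
    bergmanNorm_laplace_sq_eq_weighted hD _ hα, mul_left_comm]
  refine mul_le_mul_right ?_ _
  have hwm : Measurable (weight ν) := measurable_weight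
  -- Here u(t) = t^{-(α+1)}/w(t), which decreases since α + 1 ≥ 2(R-1).
  exact hcaus.lintegral_mul_le (ENNReal.pow_ne_top hCtop) (lintegral_causal_le hD hC hA)
    (by fun_prop) (hD.antitoneOn_div_weight (by linarith))
    (fun t ht => div_nonneg (Real.rpow_nonneg ht.le _) ENNReal.toReal_nonneg) f

/-- Regularizations lie in the Zen space and converge pointwise after composition too, so Fatou's
lemma suffices and no norm convergence is needed. -/
theorem bergmanNorm_weightedComp_le [SFinite ν] (hD : Doubling ν R)
    (hL : LaplaceSurjective ν) (hh : DifferentiableOn ℂ h rightHalfPlane)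
    (hφ : DifferentiableOn ℂ φ rightHalfPlane)
    (hmaps : MapsTo φ rightHalfPlane rightHalfPlane) (hCtop : C ≠ ∞)
    (hC : ∀ F ∈ zenSpace ν, zenNorm ν (weightedComp h φ F) ≤ C * zenNorm ν F)
    (hcausal : IsCausalOnZen ν (weightedComp h φ)) {α : ℝ} (hα : 0 ≤ α)
    (hαR : 2 * (R - 1) ≤ α) {F : ℂ → ℂ} (hF : F ∈ analyticSpace (bergmanNorm α)) :
    bergmanNorm α (weightedComp h φ F) ≤ C * bergmanNorm α F := by
  -- Off the half-plane F is arbitrary; cutting it off makes it measurable and changes nothing that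
  -- is being measured.
  set F' : ℂ → ℂ := rightHalfPlane.indicator F with hF'
  have heq : EqOn F' F rightHalfPlane := fun z hz => indicator_of_mem hz F
  have hd : DifferentiableOn ℂ F' rightHalfPlane := hF.1.congr heq
  have hm : Measurable F' := by
    classical
    rw [hF', ← piecewise_eq_indicator]
    exact hF.1.continuousOn.measurable_piecewise continuousOn_const measurableSet_rightHalfPlane
  rw [← bergmanNorm_congr α heq, ← bergmanNorm_congr α (weightedComp_congr hmaps heq)]
  have hfin : bergmanNorm α F' < ∞ := (bergmanNorm_congr α heq).trans_lt hF.2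
  set ε : ℕ → ℝ := fun n => 1 / ((n : ℝ) + 1) with hε
  have hε0 : ∀ n, 0 < ε n := fun n => by simp only [hε]; positivity
  have hb : ∀ n, bergmanNorm α (weightedComp h φ (regularize F' (ε n))) ^ 2 ≤
      (C * bergmanNorm α F') ^ 2 := fun n => by
    gcongr
    refine (bergmanNorm_weightedComp_le_of_mem_zenSpace hD hL hmaps hCtop hC hcausal hα hαR
      ⟨differentiableOn_regularize hd (hε0 n),
        zenNorm_regularize_lt_top hD hα hm hd hfin (hε0 n)⟩).trans ?_
    gcongr
    exact bergmanNorm_regularize_le hα (hε0 n)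
  refine (ENNReal.pow_le_pow_left_iff two_ne_zero).1 ?_
  simp only [bergmanNorm_sq α (weightedComp _ _ _)] at hb ⊢
  have hmeas : ∀ n, AEMeasurable (fun z => ENNReal.ofReal (z.re ^ α / Real.pi) *
      ‖weightedComp h φ (regularize F' (ε n)) z‖ₑ ^ 2) (volume.restrict rightHalfPlane) := by
    intro n
    have h1 : ContinuousOn (weightedComp h φ (regularize F' (ε n))) rightHalfPlane :=
      hh.continuousOn.mul
        ((differentiableOn_regularize hd (hε0 n)).continuousOn.comp hφ.continuousOn hmaps)
    have h2 := (h1.aemeasurable measurableSet_rightHalfPlane (μ := volume)).enorm.pow_const 2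
    have h3 := Complex.measurable_re
    exact (by fun_prop : Measurable fun z : ℂ =>
      ENNReal.ofReal (z.re ^ α / Real.pi)).aemeasurable.mul h2
  have hlim : ∀ z ∈ rightHalfPlane, Filter.liminf (fun n => ENNReal.ofReal (z.re ^ α / Real.pi) *
      ‖weightedComp h φ (regularize F' (ε n)) z‖ₑ ^ 2) Filter.atTop =
      ENNReal.ofReal (z.re ^ α / Real.pi) * ‖weightedComp h φ F' z‖ₑ ^ 2 := by
    intro z hz
    refine Filter.Tendsto.liminf_eq (ENNReal.Tendsto.const_mul ?_ (Or.inr ENNReal.ofReal_ne_top))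
    exact ((ENNReal.continuous_pow 2).tendsto _).comp
      ((tendsto_regularize hd (hmaps hz)).const_mul (h z)).enorm
  rw [← setLIntegral_congr_fun measurableSet_rightHalfPlane hlim]
  refine (lintegral_liminf_le' hmeas).trans ?_
  refine (Filter.liminf_le_liminf (Filter.Eventually.of_forall hb)).trans ?_
  simp

end Zen

theorem mainTheorem3 (ν : Measure ℝ≥0) [ν.Regular] (hν : ν ≠ 0) (hΔ : Zen.DeltaTwo ν)
    (hL : Zen.LaplaceSurjective ν) (h φ : ℂ → ℂ)
    (hh : DifferentiableOn ℂ h Zen.rightHalfPlane)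
    (hφ : DifferentiableOn ℂ φ Zen.rightHalfPlane)
    (hmaps : MapsTo φ Zen.rightHalfPlane Zen.rightHalfPlane)
    (hbdd : Zen.IsBoundedOn (Zen.zenNorm ν) (Zen.weightedComp h φ))
    (hcausal : Zen.IsCausalOnZen ν (Zen.weightedComp h φ)) :
    ∃ α' : ℝ, 0 ≤ α' ∧ ∀ α : ℝ, α' ≤ α →
      Zen.IsBoundedOn (Zen.bergmanNorm α) (Zen.weightedComp h φ) ∧
      Zen.opNorm (Zen.bergmanNorm α) (Zen.weightedComp h φ) ≤
        Zen.opNorm (Zen.zenNorm ν) (Zen.weightedComp h φ) := by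
  obtain ⟨R, hD⟩ := hΔ.exists_doubling hν
  have key : ∀ α : ℝ, max 0 (2 * (R - 1)) ≤ α → ∀ C : ℝ≥0∞, C ≠ ∞ →
      (∀ F ∈ Zen.zenSpace ν, Zen.zenNorm ν (Zen.weightedComp h φ F) ≤ C * Zen.zenNorm ν F) →
      ∀ F ∈ Zen.analyticSpace (Zen.bergmanNorm α),
        Zen.bergmanNorm α (Zen.weightedComp h φ F) ≤ C * Zen.bergmanNorm α F :=
    fun α hα C hCtop hC F hF => Zen.bergmanNorm_weightedComp_le hD hL hh hφ hmaps hCtop hC hcausal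
      ((le_max_left _ _).trans hα) ((le_max_right _ _).trans hα) hF
  -- Nonnegativity serves the regularization; 2(R-1) serves the monotonicity of u.
  refine ⟨max 0 (2 * (R - 1)), le_max_left _ _, fun α hα => ?_⟩
  have hle : Zen.opNorm (Zen.bergmanNorm α) (Zen.weightedComp h φ) ≤
      Zen.opNorm (Zen.zenNorm ν) (Zen.weightedComp h φ) := by
    refine le_sInf fun C hC => ?_
    rcases eq_or_ne C ∞ with rfl | hCtop
    · exact le_top
    · exact sInf_le (key α hα C hCtop hC)
  refine ⟨⟨fun F hF => ⟨hh.mul (hF.1.comp hφ hmaps), ?_⟩, hle.trans_lt hbdd.2⟩, hle⟩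
  -- Any finite Zen bound shows that the image has finite Bergman norm; the infimum need not be
  -- attained.
  obtain ⟨C, hC, hCtop⟩ := sInf_lt_iff.1 hbdd.2
  exact (key α hα C hCtop.ne hC F hF).trans_lt (ENNReal.mul_lt_top hCtop hF.2)
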